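/- Let $M$ be a smooth $n$-manifold without boundary (Hausdorff, second countable), let $F:M\to\mathbf R^{n+1}$ be a smooth immersion, and equip $M$ with the induced metric and its Riemannian volume measure $\mu$. Let $f=x_{n+1}\circ F$ be the height function, let $\Omega\subset M$ be open with compact closure, and let $N$ be a smooth unit normal field of $F$ on $\Omega$. Put $A(X,Y)=\langle D_XN,dF(Y)\rangle$ and $H=\operatorname{tr}A=\operatorname{div}N$, so that the mean curvature vector is $\vec H=-HN$. A variation of $F$ in $\Omega$ is a smooth family $\Psi_s:M\to\mathbf R^{n+1}$, $s\in(-\varepsilon,\varepsilon)$, with $\Psi_0=F$ and $\Psi_s=F$ outside a fixed compact subset of $\Omega$. For such a family let $$\mathcal A_f[\Psi_s(\Omega)]=\int_\Omega e^{-x_{n+1}\circ\Psi_s}\,d\mu_s ,$$ where $\mu_s$ is the area measure on $M$ induced by $\Psi_s$. (1) The translator equation $H=\langle \mathbf e_{n+1},N\rangle$ on $\Omega$ is the Euler–Lagrange equation of $\mathcal A_f$: it holds at every point of $\Omega$ if and only if $\frac{d}{ds}\big|_{s=0}\mathcal A_f[\Psi_s(\Omega)]$ exists and equals $0$ for every variation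 $\Psi$ of $F$ in $\Omega$. (2) Suppose that $H=\langle \mathbf e_{n+1},N\rangle$ on $\Omega$, let $u\in C_0^\infty(\Omega)$, and let $\Psi$ be a variation of $F$ in $\Omega$ with $\frac{\partial\Psi}{\partial s}\big|_{s=0}=uN$ (where $uN=0$ outside $\Omega$). Then $s\mapsto\mathcal A_f[\Psi_s(\Omega)]$ is differentiable near $0$ and twice differentiable at $0$, the function $e^{-f}u\,L_fu$ is integrable, and $$\frac{d^2}{ds^2}\Big|_{s=0}\mathcal A_f[\Psi_s(\Omega)]=-\int_M e^{-f}\,u\,L_fu\,d\mu,\qquad L_fu=\Delta^fu+|A|^2u,\qquad \Delta^fu=\Delta u-\langle\nabla f,\nabla u\rangle .$$ (3) For every smooth $u:M\to\mathbf R$, $\Delta^fu=\Delta u-\langle \mathbf e_{n+1},\nabla u\rangle$ on $M$, where $\nabla u$ is regarded as a vector of $\mathbf R^{n+1}$ through $dF$. -/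

import Mathlib

open scoped Manifold ContDiff Topology

noncomputable section

namespace WeightedArea

variable {n : ℕ} {M : Type*} [TopologicalSpace M] [ChartedSpace (EuclideanSpace ℝ (Fin n)) M]

/-- The ambient Euclidean space `ℝⁿ⁺¹`. -/
abbrev Amb (n : ℕ) : Type := EuclideanSpace ℝ (Fin (n + 1))

/-- The vertical unit vector `e_{n+1}`. -/
def eLast (n : ℕ) : Amb n := EuclideanSpace.single (Fin.last n) 1

/-- The height function of `F : M → ℝⁿ⁺¹`, i.e. the last coordinate restricted to `M`. -/
def height (F : M → Amb n) (x : M) : ℝ := F x (Fin.last n)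

/-- The derivative at `x` of a map on `M`, in the direction of the `i`-th vector of the basis
of `T_x M` (for a function: its `i`-th partial derivative in the preferred chart at `x`). -/
def pd {V : Type*} [NormedAddCommGroup V] [NormedSpace ℝ V] (G : M → V) (x : M) (i : Fin n) : V :=
  mfderiv (𝓡 n) 𝓘(ℝ, V) G x (EuclideanSpace.single i (1 : ℝ) : EuclideanSpace ℝ (Fin n))

/-- The first fundamental form `g i j = ⟨∂ᵢF, ∂ⱼF⟩` of `F` at `x`. -/
def metric (F : M → Amb n) (x : M) : Matrix (Fin n) (Fin n) ℝ :=
  Matrix.of fun i j => inner ℝ (pd F x i) (pd F x j)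

/-- The inner product `⟨∇u, ∇v⟩ = gⁱʲ ∂ᵢu ∂ⱼv` for the metric induced by `F`. -/
def innerGrad (F : M → Amb n) (u v : M → ℝ) (x : M) : ℝ :=
  ∑ i, ∑ j, (metric F x)⁻¹ i j * pd u x i * pd v x j

/-- The gradient of `u` for the metric induced by `F`, pushed forward to `ℝⁿ⁺¹` by `dF`. -/
def grad (F : M → Amb n) (u : M → ℝ) (x : M) : Amb n :=
  ∑ i, ∑ j, ((metric F x)⁻¹ i j * pd u x i) • pd F x j

/-- The divergence along `M` of an `ℝⁿ⁺¹`-valued field: `gⁱʲ ⟨∂ᵢV, ∂ⱼF⟩`. For a field which is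
tangent to `M` this is the divergence of the induced metric. -/
def surfaceDiv (F V : M → Amb n) (x : M) : ℝ :=
  ∑ i, ∑ j, (metric F x)⁻¹ i j * inner ℝ (pd V x i) (pd F x j)

/-- The Laplace-Beltrami operator `Δu = div ∇u` of the metric induced by `F`. -/
def laplacian (F : M → Amb n) (u : M → ℝ) (x : M) : ℝ := surfaceDiv F (grad F u) x

/-- The second fundamental form `A i j = ⟨∂ᵢN, ∂ⱼF⟩ = -⟨∂ᵢ∂ⱼF, N⟩` with respect to the
unit normal `N`. -/
def secondForm (F N : M → Amb n) (x : M) : Matrix (Fin n) (Fin n) ℝ :=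
  Matrix.of fun i j => inner ℝ (pd N x i) (pd F x j)

/-- The scalar mean curvature `H = gⁱʲ Aᵢⱼ = div N`; the mean curvature vector is `-H N`. -/
def meanCurv (F N : M → Amb n) (x : M) : ℝ :=
  ∑ i, ∑ j, (metric F x)⁻¹ i j * secondForm F N x i j

/-- `|A|² = gⁱᵏ gʲˡ Aᵢⱼ Aₖₗ`. -/
def normSqA (F N : M → Amb n) (x : M) : ℝ :=
  ∑ i, ∑ j, ∑ k, ∑ l, (metric F x)⁻¹ i k * (metric F x)⁻¹ j l *
    secondForm F N x i j * secondForm F N x k l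

/-- The drift Laplacian `Δ^f u = Δu - ⟨∇f, ∇u⟩`, where `f` is the height function. -/
def driftLaplacian (F : M → Amb n) (u : M → ℝ) (x : M) : ℝ :=
  laplacian F u x - innerGrad F (height F) u x

/-- The stability operator `L_f u = Δ^f u + |A|² u`. -/
def stabilityOp (F N : M → Amb n) (u : M → ℝ) (x : M) : ℝ :=
  driftLaplacian F u x + normSqA F N x * u x

/-- The area density `√det(⟨∂ᵢ(F ∘ φ⁻¹), ∂ⱼ(F ∘ φ⁻¹)⟩)` of `F` in the chart `φ`. -/
def chartDensity (F : M → Amb n) (φ : OpenPartialHomeomorph M (EuclideanSpace ℝ (Fin n)))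
    (y : EuclideanSpace ℝ (Fin n)) : ℝ :=
  √(Matrix.det (Matrix.of fun i j : Fin n =>
    (inner ℝ (fderiv ℝ (F ∘ φ.symm) y (EuclideanSpace.single i 1))
      (fderiv ℝ (F ∘ φ.symm) y (EuclideanSpace.single j 1)) : ℝ)))

/-- The area measure of `F` on the domain of the chart `φ`, extended by zero. -/
def chartArea [MeasurableSpace M] (F : M → Amb n)
    (φ : OpenPartialHomeomorph M (EuclideanSpace ℝ (Fin n))) : MeasureTheory.Measure M :=
  ((MeasureTheory.volume.restrict φ.target).withDensity
    fun y => ENNReal.ofReal (chartDensity F φ y)).map φ.symm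

/-- The area measure `dμ` on `M` of the metric induced by `F` (for an immersion: its Riemannian
volume measure). By the change of variables formula the measures `chartArea F φ` agree on the
overlaps of charts; their supremum is the measure which restricts to `chartArea F φ` on the
domain of each chart `φ`. -/
def areaMeasure [MeasurableSpace M] (F : M → Amb n) : MeasureTheory.Measure M :=
  ⨆ φ ∈ atlas (EuclideanSpace ℝ (Fin n)) M, chartArea F φ

/-- The weighted area `∫_Ω e^{-f} dμ`, where `f` is the height function. -/
def weightedArea [MeasurableSpace M] (F : M → Amb n) (Ω : Set M) : ℝ :=
  ∫ x in Ω, Real.exp (-height F x) ∂(areaMeasure F)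

/-- `N` is a smooth unit normal field of `F` on `Ω`. -/
structure IsUnitNormalOn (F N : M → Amb n) (Ω : Set M) : Prop where
  smooth : ContMDiffOn (𝓡 n) 𝓘(ℝ, Amb n) ∞ N Ω
  norm_eq_one : ∀ x ∈ Ω, ‖N x‖ = 1
  normal : ∀ x ∈ Ω, ∀ i : Fin n, inner ℝ (N x) (pd F x i) = 0

/-- `Ψ` is a smooth variation of `F` (defined for times in some interval `(-ε, ε)`) which is
supported in a compact subset of `Ω`. -/
structure IsVariation (F : M → Amb n) (Ω : Set M) (Ψ : ℝ → M → Amb n) : Prop where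
  smooth : ∃ ε > 0, ContMDiffOn (𝓘(ℝ, ℝ).prod (𝓡 n)) 𝓘(ℝ, Amb n) ∞
    (fun p : ℝ × M => Ψ p.1 p.2) (Set.Ioo (-ε) ε ×ˢ Set.univ)
  zero : Ψ 0 = F
  support : ∃ ε > 0, ∃ K : Set M, IsCompact K ∧ K ⊆ Ω ∧
    ∀ s ∈ Set.Ioo (-ε) ε, ∀ x ∉ K, Ψ s x = F x

/-- `F` is a stationary point of the weighted area of `Ω`: its first variation vanishes for all
smooth variations which are compactly supported in `Ω`. -/
def IsStationaryOn [MeasurableSpace M] (F : M → Amb n) (Ω : Set M) : Prop :=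
  ∀ Ψ : ℝ → M → Amb n, IsVariation F Ω Ψ → HasDerivAt (fun s => weightedArea (Ψ s) Ω) 0 0

/-- The translator equation `H = ⟨e_{n+1}, N⟩` on `Ω`. -/
def TranslatorEqOn (F N : M → Amb n) (Ω : Set M) : Prop :=
  ∀ x ∈ Ω, meanCurv F N x = inner ℝ (eLast n) (N x)

end WeightedArea

end

/-! All areas are written against the fixed measure dμ of F: dμ_s has density √(det g_s / det g), so
the weighted area of Ψ_s is ∫_Ω w_s dμ with w_s = e^{-x_{n+1}∘Ψ_s} √(det g_s / det g)
(`areaMeasure_eq_withDensity`, `weightedArea_eq_setIntegral`). Off a fixed compact set w_s does not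
depend on s, so it may be differentiated under the integral.

With X = ∂_sΨ, Jacobi's formula gives w' = w (div X - ⟨e,X⟩). Split X = T + cN at s = 0. The
tangential part contributes e^{-f}(div T - ⟨e,T⟩) = div(e^{-f}T), whose integral is zero by the
divergence theorem (`integral_surfaceDiv_eq_zero`), and what remains is ∫ e^{-f} c (H - ⟨e,N⟩)
(`integral_weightedDiv`). This yields (1); for the converse one tests with c a cut-off multiple of H
- ⟨e,N⟩.

For (2), w'' = w((div X - ⟨e,X⟩)² + Q + (div Y - ⟨e,Y⟩)), where Y is the acceleration and Q is
quadratic in dX. If X = uN on a translator, the square vanishes pointwise, Q = |∇u|² - u²|A|²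
(`frameHess_normal`), and the Y term is a first variation, hence integrates to zero. Integrating
div(e^{-f}u∇u) = e^{-f}(|∇u|² + uΔ^f u) turns the rest into -∫ e^{-f} u L_f u. Part (3) holds
because ∂_i f = ⟨e,∂_iF⟩.

The geometric quantities are defined through `pd`, which uses a different chart at each point; local
calculus is done with `cpd` in one fixed chart. The two are linked by invariance under a linear
change of frame (`frameDiv_changeFrame`, `frameGrad_changeFrame`, `det_gram_changeFrame`). -/

noncomputable section

set_option linter.unusedSectionVars false

namespace WeightedArea

/-! ### Gram matrices of frames: invariance under change of frame, and derivatives in time. -/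

section LinearAlgebra

variable {ι V : Type*} [Fintype ι] [DecidableEq ι] [NormedAddCommGroup V] [InnerProductSpace ℝ V]

/-- The matrix `⟨Q i, P j⟩` of inner products of two families of vectors. -/
def crossGram (P Q : ι → V) : Matrix ι ι ℝ := Matrix.of fun i j => inner ℝ (Q i) (P j)

/-- The trace `gⁱʲ ⟨Q i, P j⟩` with respect to the Gram matrix `g` of `P`. -/
def frameDiv (P Q : ι → V) : ℝ :=
  ∑ i, ∑ j, (Matrix.gram ℝ P)⁻¹ i j * inner ℝ (Q i) (P j)

/-- The family obtained from `P` by a linear change of frame. -/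
def changeFrame {W : Type*} [AddCommGroup W] [Module ℝ W] (D : Matrix ι ι ℝ) (P : ι → W) : ι → W :=
  fun i => ∑ k, D k i • P k

lemma gram_inv_symm (P : ι → V) (i j : ι) :
    (Matrix.gram ℝ P)⁻¹ i j = (Matrix.gram ℝ P)⁻¹ j i := by
  have h := (Matrix.isHermitian_gram ℝ P).inv
  have := congrFun (congrFun h j) i
  simpa using this

lemma gram_transpose (P : ι → V) : (Matrix.gram ℝ P).transpose = Matrix.gram ℝ P := by
  ext i j
  simp [Matrix.gram_apply, real_inner_comm]

lemma frameDiv_eq_trace (P Q : ι → V) :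
    frameDiv P Q = ((Matrix.gram ℝ P)⁻¹ * crossGram P Q).trace := by
  simp only [frameDiv, Matrix.trace, Matrix.diag, Matrix.mul_apply, crossGram, Matrix.of_apply]
  rw [Finset.sum_comm]
  exact Finset.sum_congr rfl fun i _ => Finset.sum_congr rfl fun j _ => by rw [gram_inv_symm]

lemma crossGram_changeFrame (D : Matrix ι ι ℝ) (P Q : ι → V) :
    crossGram (changeFrame D P) (changeFrame D Q) = D.transpose * crossGram P Q * D := by
  ext i j
  simp only [crossGram, changeFrame, Matrix.of_apply, Matrix.mul_apply, Matrix.transpose_apply,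
    sum_inner, inner_sum, real_inner_smul_left, real_inner_smul_right, Finset.sum_mul]
  exact Finset.sum_congr rfl fun k _ => Finset.sum_congr rfl fun l _ => by ring

lemma gram_changeFrame (D : Matrix ι ι ℝ) (P : ι → V) :
    Matrix.gram ℝ (changeFrame D P) = D.transpose * Matrix.gram ℝ P * D :=
  crossGram_changeFrame D P P

lemma det_gram_changeFrame (D : Matrix ι ι ℝ) (P : ι → V) :
    (Matrix.gram ℝ (changeFrame D P)).det = D.det ^ 2 * (Matrix.gram ℝ P).det := by
  rw [gram_changeFrame, Matrix.det_mul, Matrix.det_mul, Matrix.det_transpose]; ring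

/-- With g the Gram matrix and C the cross Gram matrix, both become DᵀgD and DᵀCD, so g⁻¹C is
conjugated by D and its trace is unchanged. This makes the divergence independent of the chart. -/
lemma frameDiv_changeFrame {D : Matrix ι ι ℝ} (hD : IsUnit D.det) (P Q : ι → V) :
    frameDiv (changeFrame D P) (changeFrame D Q) = frameDiv P Q := by
  rw [frameDiv_eq_trace, frameDiv_eq_trace, gram_changeFrame, crossGram_changeFrame,
    Matrix.mul_inv_rev, Matrix.mul_inv_rev]
  have hDt : IsUnit D.transpose.det := by rwa [Matrix.det_transpose]
  have : D⁻¹ * ((Matrix.gram ℝ P)⁻¹ * D.transpose⁻¹) * (D.transpose * crossGram P Q * D)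
      = D⁻¹ * ((Matrix.gram ℝ P)⁻¹ * (D.transpose⁻¹ * D.transpose) * crossGram P Q * D) := by
    simp only [Matrix.mul_assoc]
  rw [this, Matrix.nonsing_inv_mul _ hDt, Matrix.mul_one, Matrix.trace_mul_comm, Matrix.mul_assoc,
    Matrix.mul_nonsing_inv _ hD, Matrix.mul_one]

/-- The vector with `⟨·, P i⟩ = a i` in the span of `P`. -/
def frameGrad (P : ι → V) (a : ι → ℝ) : V :=
  ∑ i, ∑ j, ((Matrix.gram ℝ P)⁻¹ i j * a i) • P j

lemma sum_gram_mul_inv {P : ι → V} (hP : (Matrix.gram ℝ P).det ≠ 0) (i j : ι) :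
    ∑ k, inner ℝ (P i) (P k) * (Matrix.gram ℝ P)⁻¹ k j = if i = j then 1 else 0 := by
  have := congrFun (congrFun (Matrix.mul_nonsing_inv _ (isUnit_iff_ne_zero.2 hP)) i) j
  simpa [Matrix.mul_apply, Matrix.gram_apply, Matrix.one_apply] using this

lemma inner_frameGrad {P : ι → V} (hP : (Matrix.gram ℝ P).det ≠ 0) (a : ι → ℝ) (k : ι) :
    inner ℝ (frameGrad P a) (P k) = a k := by
  simp only [frameGrad, sum_inner, real_inner_smul_left]
  calc _ = ∑ i, a i * ∑ j, inner ℝ (P k) (P j) * (Matrix.gram ℝ P)⁻¹ j i := by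
        refine Finset.sum_congr rfl fun i _ => ?_
        rw [Finset.mul_sum]
        refine Finset.sum_congr rfl fun j _ => ?_
        rw [real_inner_comm, gram_inv_symm]; ring
    _ = a k := by simp [sum_gram_mul_inv hP]

lemma frameGrad_mem_span (P : ι → V) (a : ι → ℝ) :
    frameGrad P a ∈ Submodule.span ℝ (Set.range P) :=
  Submodule.sum_mem _ fun _ _ => Submodule.sum_mem _ fun j _ =>
    Submodule.smul_mem _ _ (Submodule.subset_span ⟨j, rfl⟩)

/-- The difference lies in the span and is orthogonal to it; linear independence of `P` plays no
role. -/
lemma eq_of_inner_frame_eq {P : ι → V} {v w : V} (hv : v ∈ Submodule.span ℝ (Set.range P))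
    (hw : w ∈ Submodule.span ℝ (Set.range P)) (h : ∀ k, inner ℝ v (P k) = inner ℝ w (P k)) :
    v = w := by
  have hvw : v - w ∈ Submodule.span ℝ (Set.range P) := Submodule.sub_mem _ hv hw
  have : ∀ z ∈ Submodule.span ℝ (Set.range P), inner ℝ (v - w) z = 0 := by
    intro z hz
    induction hz using Submodule.span_induction with
    | mem z hz => obtain ⟨k, rfl⟩ := hz; rw [inner_sub_left, h, sub_self]
    | zero => simp
    | add a b _ _ ha hb => rw [inner_add_right, ha, hb, add_zero]
    | smul c a _ ha => rw [real_inner_smul_right, ha, mul_zero]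
  exact sub_eq_zero.1 (inner_self_eq_zero.1 (this _ hvw))

/-- Expansion of a vector in the span of the frame. -/
lemma eq_frameGrad {P : ι → V} (hP : (Matrix.gram ℝ P).det ≠ 0) {v : V}
    (hv : v ∈ Submodule.span ℝ (Set.range P)) : v = frameGrad P fun i => inner ℝ v (P i) :=
  eq_of_inner_frame_eq hv (frameGrad_mem_span _ _) fun k => by rw [inner_frameGrad hP]

lemma changeFrame_mem_span (D : Matrix ι ι ℝ) (P : ι → V) (i : ι) :
    changeFrame D P i ∈ Submodule.span ℝ (Set.range P) :=
  Submodule.sum_mem _ fun k _ => Submodule.smul_mem _ _ (Submodule.subset_span ⟨k, rfl⟩)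

lemma inner_eq_sum_frameGrad (P : ι → V) (a : ι → ℝ) (v : V) :
    inner ℝ v (frameGrad P a) = ∑ i, ∑ j, (Matrix.gram ℝ P)⁻¹ i j * a i * inner ℝ v (P j) := by
  simp only [frameGrad, inner_sum, real_inner_smul_right]

lemma span_changeFrame_le (D : Matrix ι ι ℝ) (P : ι → V) :
    Submodule.span ℝ (Set.range (changeFrame D P)) ≤ Submodule.span ℝ (Set.range P) := by
  rw [Submodule.span_le]
  rintro _ ⟨i, rfl⟩
  exact changeFrame_mem_span D P i

lemma changeFrame_changeFrame {W : Type*} [AddCommGroup W] [Module ℝ W] (D D' : Matrix ι ι ℝ)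
    (P : ι → W) : changeFrame D' (changeFrame D P) = changeFrame (D * D') P := by
  funext i
  simp only [changeFrame, Finset.smul_sum, Matrix.mul_apply, Finset.sum_smul, smul_smul]
  rw [Finset.sum_comm]
  exact Finset.sum_congr rfl fun k _ => Finset.sum_congr rfl fun l _ => by rw [mul_comm]

lemma changeFrame_one {W : Type*} [AddCommGroup W] [Module ℝ W] (P : ι → W) :
    changeFrame (1 : Matrix ι ι ℝ) P = P := by
  funext i; simp [changeFrame, Matrix.one_apply, ite_smul]

lemma span_changeFrame {D : Matrix ι ι ℝ} (hD : IsUnit D.det) (P : ι → V) :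
    Submodule.span ℝ (Set.range (changeFrame D P)) = Submodule.span ℝ (Set.range P) := by
  refine le_antisymm (span_changeFrame_le D P) ?_
  have := span_changeFrame_le D⁻¹ (changeFrame D P)
  rwa [changeFrame_changeFrame, Matrix.mul_nonsing_inv _ hD, changeFrame_one] at this

/-- Both vectors lie in the common span and have the same products with the new frame, because the
components `a` transform by the same matrix as the frame. This makes the gradient independent of the
chart. -/
lemma frameGrad_changeFrame {D : Matrix ι ι ℝ} (hD : IsUnit D.det) {P : ι → V}
    (hP : (Matrix.gram ℝ P).det ≠ 0) (a : ι → ℝ) :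
    frameGrad (changeFrame D P) (changeFrame D a) = frameGrad P a := by
  have hP' : (Matrix.gram ℝ (changeFrame D P)).det ≠ 0 := by
    rw [det_gram_changeFrame]; exact mul_ne_zero (pow_ne_zero _ hD.ne_zero) hP
  refine eq_of_inner_frame_eq (P := changeFrame D P) (frameGrad_mem_span _ _)
    (by rw [span_changeFrame hD]; exact frameGrad_mem_span _ _) fun k => ?_
  rw [inner_frameGrad hP']
  simp only [changeFrame, inner_sum, real_inner_smul_right, inner_frameGrad hP, smul_eq_mul]

/-- A vector orthogonal to the normal of a hyperplane frame is tangential. -/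
lemma mem_span_of_inner_normal_eq_zero {n : ℕ} {P : Fin n → Amb n}
    (hP : (Matrix.gram ℝ P).det ≠ 0) {ν v : Amb n} (hν : ‖ν‖ = 1)
    (hνP : ∀ i, inner ℝ ν (P i) = 0) (hv : inner ℝ ν v = 0) :
    v ∈ Submodule.span ℝ (Set.range P) := by
  have hlin := Matrix.linearIndependent_of_det_gram_ne_zero hP
  have : Fact (Module.finrank ℝ (Amb n) = n + 1) := ⟨by simp⟩
  have hν0 : ν ≠ 0 := by rintro rfl; simp at hν
  have hle : Submodule.span ℝ (Set.range P) ≤ (Submodule.span ℝ {ν})ᗮ := by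
    rw [Submodule.span_le]
    rintro _ ⟨i, rfl⟩
    exact Submodule.mem_orthogonal_singleton_iff_inner_right.2 (hνP i)
  -- The inclusion is an equality by dimension: n independent vectors inside a hyperplane of ℝⁿ⁺¹.
  have heq : Submodule.span ℝ (Set.range P) = (Submodule.span ℝ {ν})ᗮ := by
    refine Submodule.eq_of_le_of_finrank_eq hle ?_
    rw [finrank_span_eq_card hlin, Submodule.finrank_orthogonal_span_singleton (n := n) hν0,
      Fintype.card_fin]
  rw [heq]
  exact Submodule.mem_orthogonal_singleton_iff_inner_right.2 hv

/-- Jacobi's formula. -/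
lemma hasDerivAt_det {G : ℝ → Matrix ι ι ℝ} {G' : Matrix ι ι ℝ} {t : ℝ}
    (h : ∀ i j, HasDerivAt (fun s => G s i j) (G' i j) t) (hdet : (G t).det ≠ 0) :
    HasDerivAt (fun s => (G s).det) ((G t).det * ((G t)⁻¹ * G').trace) t := by
  have h1 : HasDerivAt (fun s => (G s).det) (∑ σ : Equiv.Perm ι,
      ((Equiv.Perm.sign σ : ℤ) : ℝ) *
        ∑ i, (∏ j ∈ Finset.univ.erase i, G t (σ j) j) • G' (σ i) i) t := by
    simp only [Matrix.det_apply']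
    refine HasDerivAt.fun_sum fun σ _ => ?_
    refine HasDerivAt.const_mul _ ?_
    exact HasDerivAt.fun_finsetProd fun i _ => h (σ i) i
  convert h1 using 1
  have hadj : (G t).det * ((G t)⁻¹ * G').trace = ((G t).adjugate * G').trace := by
    rw [Matrix.inv_def, Matrix.smul_mul, Matrix.trace_smul, smul_eq_mul, ← mul_assoc,
      Ring.inverse_eq_inv', mul_inv_cancel₀ hdet, one_mul]
  rw [hadj]
  simp only [Finset.mul_sum]
  rw [Finset.sum_comm]
  simp only [Matrix.trace, Matrix.diag]
  refine Finset.sum_congr rfl fun i _ => ?_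
  -- Cramer's rule: the i-th diagonal entry of adj(G)·G' is the determinant of G with column i
  -- replaced by that of G'. Its Leibniz expansion is the product-rule term in which the i-th factor
  -- is differentiated.
  have : ((G t).adjugate * G') i i = ((G t).updateCol i fun k => G' k i).det := by
    rw [← Matrix.cramer_apply, Matrix.cramer_eq_adjugate_mulVec]
    simp [Matrix.mul_apply, Matrix.mulVec, dotProduct]
  rw [this, Matrix.det_apply']
  refine Finset.sum_congr rfl fun σ _ => ?_
  congr 1
  rw [← Finset.mul_prod_erase Finset.univ _ (Finset.mem_univ i), Matrix.updateCol_self,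
    smul_eq_mul, mul_comm]
  congr 1
  exact Finset.prod_congr rfl fun j hj => by
    rw [Matrix.updateCol_ne (Finset.ne_of_mem_erase hj)]

lemma hasDerivAt_matrix_inv {G : ℝ → Matrix ι ι ℝ} {G' : Matrix ι ι ℝ} {t : ℝ}
    (h : ∀ i j, HasDerivAt (fun s => G s i j) (G' i j) t) (hdet : (G t).det ≠ 0) (i j : ι) :
    HasDerivAt (fun s => (G s)⁻¹ i j) (-((G t)⁻¹ * G' * (G t)⁻¹) i j) t := by
  -- An auxiliary submultiplicative norm, so that the derivative of inversion in a normed ring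
  -- applies; the entrywise conclusion does not involve it.
  let _ : NormedRing (Matrix ι ι ℝ) := Matrix.linftyOpNormedRing
  let _ : NormedAlgebra ℝ (Matrix ι ι ℝ) := Matrix.linftyOpNormedAlgebra
  have hG : HasDerivAt G G' t := by
    have h1 : HasDerivAt (fun s => ∑ i, ∑ j, (G s i j) • Matrix.single i j (1 : ℝ))
        (∑ i, ∑ j, (G' i j) • Matrix.single i j (1 : ℝ)) t :=
      HasDerivAt.fun_sum fun i _ => HasDerivAt.fun_sum fun j _ => (h i j).smul_const _
    have h2 : ∀ A : Matrix ι ι ℝ, ∑ i, ∑ j, (A i j) • Matrix.single i j (1 : ℝ) = A := by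
      intro A
      conv_rhs => rw [Matrix.matrix_eq_sum_single A]
      simp [Matrix.smul_single]
    simpa only [h2] using h1
  obtain ⟨u, hu⟩ : IsUnit (G t) :=
    (Matrix.isUnit_iff_isUnit_det _).2 (isUnit_iff_ne_zero.2 hdet)
  have h1 := hasFDerivAt_ringInverse (𝕜 := ℝ) u
  rw [hu] at h1
  have h2 := h1.comp_hasDerivAt t hG
  have h3 := ((Matrix.entryLinearMap ℝ ℝ i j).toContinuousLinearMap).hasFDerivAt.comp_hasDerivAt
    t h2
  have hu' : (↑u⁻¹ : Matrix ι ι ℝ) = (G t)⁻¹ := by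
    rw [Matrix.coe_units_inv, hu]
  have h4 : (fun s => (G s)⁻¹ i j) = ⇑(LinearMap.toContinuousLinearMap
      (Matrix.entryLinearMap ℝ ℝ i j)) ∘ Ring.inverse ∘ G := by
    funext s
    simp [Matrix.nonsing_inv_eq_ringInverse]
  have h5 : -((G t)⁻¹ * G' * (G t)⁻¹) i j = (LinearMap.toContinuousLinearMap
      (Matrix.entryLinearMap ℝ ℝ i j))
        ((-((ContinuousLinearMap.mulLeftRight ℝ (Matrix ι ι ℝ)) ↑u⁻¹) ↑u⁻¹) G') := by
    rw [hu']
    simp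
  rw [h4, h5]
  exact h3

lemma hasDerivAt_gram {P : ℝ → ι → V} {P' : ι → V} {t : ℝ}
    (h : ∀ i, HasDerivAt (fun s => P s i) (P' i) t) (i j : ι) :
    HasDerivAt (fun s => Matrix.gram ℝ (P s) i j)
      ((crossGram (P t) P' + (crossGram (P t) P').transpose) i j) t := by
  have := (h i).inner ℝ (h j)
  simp only [Matrix.gram_apply, crossGram, Matrix.add_apply, Matrix.of_apply,
    Matrix.transpose_apply]
  refine this.congr_deriv ?_
  rw [add_comm, real_inner_comm (P t i)]

/-- First variation of the area density of a frame. -/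
lemma hasDerivAt_sqrt_det_gram {P : ℝ → ι → V} {P' : ι → V} {t : ℝ}
    (h : ∀ i, HasDerivAt (fun s => P s i) (P' i) t) (hP : (Matrix.gram ℝ (P t)).det ≠ 0) :
    HasDerivAt (fun s => √(Matrix.gram ℝ (P s)).det)
      (√(Matrix.gram ℝ (P t)).det * frameDiv (P t) P') t := by
  have hpos : 0 < (Matrix.gram ℝ (P t)).det :=
    lt_of_le_of_ne (Matrix.posSemidef_gram ℝ (P t)).det_nonneg hP.symm
  have h1 := (hasDerivAt_det (hasDerivAt_gram h) hP).sqrt hP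
  refine h1.congr_deriv ?_
  symm
  -- The derivative of the Gram matrix is C + Cᵀ, and both summands have the same trace against g⁻¹;
  -- the resulting factor 2 cancels the 2 from the square root.
  have h2 : ((Matrix.gram ℝ (P t))⁻¹ * (crossGram (P t) P').transpose).trace
      = frameDiv (P t) P' := by
    rw [frameDiv_eq_trace, ← Matrix.trace_transpose, Matrix.transpose_mul,
      Matrix.transpose_transpose, Matrix.trace_mul_comm, Matrix.transpose_nonsing_inv,
      gram_transpose]
  rw [Matrix.mul_add, Matrix.trace_add, h2, ← frameDiv_eq_trace]
  have h3 := Real.mul_self_sqrt hpos.le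
  have h4 : √(Matrix.gram ℝ (P t)).det ≠ 0 := (Real.sqrt_pos.2 hpos).ne'
  field_simp
  linear_combination 2 * frameDiv (P t) P' * h3

/-- The trace `gⁱʲ ⟨Q i, Q j⟩` with respect to the Gram matrix `g` of `P`. -/
def frameNormSq (P Q : ι → V) : ℝ :=
  ∑ i, ∑ j, (Matrix.gram ℝ P)⁻¹ i j * inner ℝ (Q i) (Q j)

/-- Product rule for gⁱʲ⟨P'_i, P_j⟩: the subtracted sum comes from the inverse Gram matrix,
`frameNormSq` from differentiating P_j, and the term in `P''` from the acceleration. -/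
lemma hasDerivAt_frameDiv {P P' : ℝ → ι → V} {P'' : ι → V} {t : ℝ}
    (h : ∀ i, HasDerivAt (fun s => P s i) (P' t i) t)
    (h' : ∀ i, HasDerivAt (fun s => P' s i) (P'' i) t) (hP : (Matrix.gram ℝ (P t)).det ≠ 0) :
    HasDerivAt (fun s => frameDiv (P s) (P' s))
      (frameDiv (P t) P'' + frameNormSq (P t) (P' t) -
        ∑ i, ∑ j, ((Matrix.gram ℝ (P t))⁻¹ *
          (crossGram (P t) (P' t) + (crossGram (P t) (P' t)).transpose) *
          (Matrix.gram ℝ (P t))⁻¹) i j * crossGram (P t) (P' t) i j) t := by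
  have h1 : HasDerivAt (fun s => frameDiv (P s) (P' s)) (∑ i, ∑ j,
      ((-((Matrix.gram ℝ (P t))⁻¹ *
          (crossGram (P t) (P' t) + (crossGram (P t) (P' t)).transpose) *
          (Matrix.gram ℝ (P t))⁻¹) i j) * inner ℝ (P' t i) (P t j) +
        (Matrix.gram ℝ (P t))⁻¹ i j *
          (inner ℝ (P' t i) (P' t j) + inner ℝ (P'' i) (P t j)))) t :=
    HasDerivAt.fun_sum fun i _ => HasDerivAt.fun_sum fun j _ =>
      (hasDerivAt_matrix_inv (hasDerivAt_gram h) hP i j).mul ((h' i).inner ℝ (h j))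
  refine h1.congr_deriv ?_
  symm
  simp only [frameDiv, frameNormSq, ← Finset.sum_add_distrib, ← Finset.sum_sub_distrib]
  refine Finset.sum_congr rfl fun i _ => Finset.sum_congr rfl fun j _ => ?_
  simp only [crossGram, Matrix.of_apply]
  ring

end LinearAlgebra
-- Partial derivatives in charts and their transformation rules.
section Charts

variable {n : ℕ} {M : Type*} [TopologicalSpace M] [ChartedSpace (EuclideanSpace ℝ (Fin n)) M]
  [IsManifold (𝓡 n) ∞ M]
variable {V W : Type*} [NormedAddCommGroup V] [NormedSpace ℝ V]
  [NormedAddCommGroup W] [NormedSpace ℝ W]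

/-- The coordinate partial derivatives of a map on `M` in the chart `φ`. -/
def cpd (φ : OpenPartialHomeomorph M (EuclideanSpace ℝ (Fin n))) (G : M → V)
    (y : EuclideanSpace ℝ (Fin n)) (i : Fin n) : V :=
  fderiv ℝ (G ∘ φ.symm) y (EuclideanSpace.single i 1)

/-- The Jacobian matrix of the change of coordinates from `ψ` to `φ`. -/
def transMat (φ ψ : OpenPartialHomeomorph M (EuclideanSpace ℝ (Fin n)))
    (y : EuclideanSpace ℝ (Fin n)) : Matrix (Fin n) (Fin n) ℝ :=
  Matrix.of fun k i => fderiv ℝ (φ ∘ ψ.symm) y (EuclideanSpace.single i 1) k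

lemma contDiffAt_comp_symm {φ : OpenPartialHomeomorph M (EuclideanSpace ℝ (Fin n))}
    (hφ : φ ∈ atlas (EuclideanSpace ℝ (Fin n)) M) {G : M → V} {y : EuclideanSpace ℝ (Fin n)}
    (hy : y ∈ φ.target) (hG : ContMDiffAt (𝓡 n) 𝓘(ℝ, V) ∞ G (φ.symm y)) :
    ContDiffAt ℝ ∞ (G ∘ φ.symm) y := by
  have h1 := contMDiffAt_symm_of_mem_maximalAtlas (I := 𝓡 n) (n := ∞)
    (IsManifold.subset_maximalAtlas hφ) hy
  exact (hG.comp y h1).contDiffAt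

lemma contMDiffAt_of_comp_symm {φ : OpenPartialHomeomorph M (EuclideanSpace ℝ (Fin n))}
    (hφ : φ ∈ atlas (EuclideanSpace ℝ (Fin n)) M) {G : M → V} {x : M} (hx : x ∈ φ.source)
    (hG : ContDiffAt ℝ ∞ (G ∘ φ.symm) (φ x)) : ContMDiffAt (𝓡 n) 𝓘(ℝ, V) ∞ G x := by
  have h1 := contMDiffAt_of_mem_maximalAtlas (I := 𝓡 n) (n := ∞)
    (IsManifold.subset_maximalAtlas hφ) hx
  refine (hG.contMDiffAt.comp x h1).congr_of_eventuallyEq ?_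
  filter_upwards [φ.open_source.mem_nhds hx] with z hz
  simp [φ.left_inv hz]

lemma contDiffOn_comp_symm {φ : OpenPartialHomeomorph M (EuclideanSpace ℝ (Fin n))}
    (hφ : φ ∈ atlas (EuclideanSpace ℝ (Fin n)) M) {G : M → V}
    (hG : ContMDiff (𝓡 n) 𝓘(ℝ, V) ∞ G) : ContDiffOn ℝ ∞ (G ∘ φ.symm) φ.target := fun _ hy =>
  (contDiffAt_comp_symm hφ hy (hG _)).contDiffWithinAt

lemma hasFDerivAt_comp_symm {φ : OpenPartialHomeomorph M (EuclideanSpace ℝ (Fin n))}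
    (hφ : φ ∈ atlas (EuclideanSpace ℝ (Fin n)) M) {G : M → V} {y : EuclideanSpace ℝ (Fin n)}
    (hy : y ∈ φ.target) (hG : ContMDiffAt (𝓡 n) 𝓘(ℝ, V) ∞ G (φ.symm y)) :
    HasFDerivAt (G ∘ φ.symm) (fderiv ℝ (G ∘ φ.symm) y) y :=
  ((contDiffAt_comp_symm hφ hy hG).differentiableAt (by simp)).hasFDerivAt

lemma pd_eq_cpd {G : M → V} {x : M} (hG : ContMDiffAt (𝓡 n) 𝓘(ℝ, V) ∞ G x) :
    pd G x = cpd (chartAt (EuclideanSpace ℝ (Fin n)) x) G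
      (chartAt (EuclideanSpace ℝ (Fin n)) x x) := by
  funext i
  have h := hG.mdifferentiableAt (by simp)
  -- `mfderiv` has the default value zero at points of non-differentiability; `h` selects the other
  -- branch.
  simp only [pd, cpd, mfderiv, h]
  simp [writtenInExtChartAt, extChartAt, fderivWithin_univ]
  rfl

/-- The chain rule for (G ∘ φ⁻¹) ∘ (φ ∘ ψ⁻¹), which agrees with G ∘ ψ⁻¹ only near ψ x, where ψ⁻¹
still lands in the domain of φ. -/
lemma fderiv_comp_symm_trans {φ ψ : OpenPartialHomeomorph M (EuclideanSpace ℝ (Fin n))}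
    (hφ : φ ∈ atlas (EuclideanSpace ℝ (Fin n)) M) (hψ : ψ ∈ atlas (EuclideanSpace ℝ (Fin n)) M)
    {G : M → V} {x : M} (hx : x ∈ φ.source) (hx' : x ∈ ψ.source)
    (hG : ContMDiffAt (𝓡 n) 𝓘(ℝ, V) ∞ G x) :
    fderiv ℝ (G ∘ ψ.symm) (ψ x) =
      (fderiv ℝ (G ∘ φ.symm) (φ x)).comp (fderiv ℝ (φ ∘ ψ.symm) (ψ x)) := by
  have h1 := hasFDerivAt_comp_symm hφ (φ.map_source hx) (G := G) (by rwa [φ.left_inv hx])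
  have h2 := hasFDerivAt_comp_symm (V := EuclideanSpace ℝ (Fin n)) hψ (ψ.map_source hx')
    (G := φ) (by
      rw [ψ.left_inv hx']
      exact contMDiffAt_of_mem_maximalAtlas (IsManifold.subset_maximalAtlas hφ) hx)
  have h3 : HasFDerivAt (G ∘ φ.symm) (fderiv ℝ (G ∘ φ.symm) (φ x)) ((φ ∘ ψ.symm) (ψ x)) := by
    simpa [ψ.left_inv hx'] using h1
  refine ((h3.comp _ h2).congr_of_eventuallyEq ?_).fderiv
  have hc : ContinuousAt ψ.symm (ψ x) := ψ.continuousAt_symm (ψ.map_source hx')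
  have : ∀ᶠ y in 𝓝 (ψ x), ψ.symm y ∈ φ.source :=
    hc (by rw [ψ.left_inv hx']; exact φ.open_source.mem_nhds hx)
  filter_upwards [this] with y hy
  simp [φ.left_inv hy]

lemma euclidean_eq_sum (v : EuclideanSpace ℝ (Fin n)) :
    v = ∑ k, v k • EuclideanSpace.single k (1 : ℝ) := by
  ext i
  simp [Pi.single_apply]

/-- Change of coordinates for partial derivatives. -/
lemma cpd_changeFrame {φ ψ : OpenPartialHomeomorph M (EuclideanSpace ℝ (Fin n))}
    (hφ : φ ∈ atlas (EuclideanSpace ℝ (Fin n)) M) (hψ : ψ ∈ atlas (EuclideanSpace ℝ (Fin n)) M)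
    {G : M → V} {x : M} (hx : x ∈ φ.source) (hx' : x ∈ ψ.source)
    (hG : ContMDiffAt (𝓡 n) 𝓘(ℝ, V) ∞ G x) :
    cpd ψ G (ψ x) = changeFrame (transMat φ ψ (ψ x)) (cpd φ G (φ x)) := by
  funext i
  simp only [cpd, changeFrame, transMat, Matrix.of_apply]
  rw [fderiv_comp_symm_trans hφ hψ hx hx' hG, ContinuousLinearMap.comp_apply]
  conv_lhs => rw [euclidean_eq_sum (fderiv ℝ (φ ∘ ψ.symm) (ψ x) _)]
  simp only [map_sum, map_smul]

/-- Apply the change of coordinates to the map φ itself: its partial derivatives in its own chart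
are the standard basis. -/
lemma transMat_mul {φ ψ : OpenPartialHomeomorph M (EuclideanSpace ℝ (Fin n))}
    (hφ : φ ∈ atlas (EuclideanSpace ℝ (Fin n)) M) (hψ : ψ ∈ atlas (EuclideanSpace ℝ (Fin n)) M)
    {x : M} (hx : x ∈ φ.source) (hx' : x ∈ ψ.source) :
    transMat φ ψ (ψ x) * transMat ψ φ (φ x) = 1 := by
  have h := cpd_changeFrame (V := EuclideanSpace ℝ (Fin n)) hψ hφ (G := φ) hx' hx
    (contMDiffAt_of_mem_maximalAtlas (IsManifold.subset_maximalAtlas hφ) hx)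
  ext k i
  have h1 : cpd φ φ (φ x) i = EuclideanSpace.single i (1 : ℝ) := by
    have : (φ ∘ φ.symm) =ᶠ[𝓝 (φ x)] id := by
      filter_upwards [φ.open_target.mem_nhds (φ.map_source hx)] with y hy
      simp [φ.right_inv hy]
    rw [cpd, this.fderiv_eq, fderiv_id]; rfl
  have h2 := congrArg (fun v : EuclideanSpace ℝ (Fin n) => v k) ((congrFun h i).symm.trans h1)
  simp only [changeFrame, cpd] at h2
  rw [Matrix.mul_apply, Matrix.one_apply]
  simp only [WithLp.ofLp_sum, WithLp.ofLp_smul, Finset.sum_apply, Pi.smul_apply, smul_eq_mul,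
    PiLp.single_apply] at h2
  rw [← h2]
  exact Finset.sum_congr rfl fun j _ => mul_comm _ _

lemma isUnit_det_transMat {φ ψ : OpenPartialHomeomorph M (EuclideanSpace ℝ (Fin n))}
    (hφ : φ ∈ atlas (EuclideanSpace ℝ (Fin n)) M) (hψ : ψ ∈ atlas (EuclideanSpace ℝ (Fin n)) M)
    {x : M} (hx : x ∈ φ.source) (hx' : x ∈ ψ.source) : IsUnit (transMat φ ψ (ψ x)).det :=
  (Matrix.isUnit_iff_isUnit_det _).1 (IsUnit.of_mul_eq_one _ (transMat_mul hφ hψ hx hx'))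

lemma det_transMat (φ ψ : OpenPartialHomeomorph M (EuclideanSpace ℝ (Fin n)))
    (y : EuclideanSpace ℝ (Fin n)) :
    (transMat φ ψ y).det = (fderiv ℝ (φ ∘ ψ.symm) y).det := by
  rw [ContinuousLinearMap.det, ← LinearMap.det_toMatrix
    (EuclideanSpace.basisFun (Fin n) ℝ).toBasis]
  congr 1

/-- The coordinate frame at `x` of the chart `φ` in terms of the one used by `pd`. -/
def frameMat (φ : OpenPartialHomeomorph M (EuclideanSpace ℝ (Fin n))) (x : M) :
    Matrix (Fin n) (Fin n) ℝ :=
  transMat φ (chartAt (EuclideanSpace ℝ (Fin n)) x) (chartAt (EuclideanSpace ℝ (Fin n)) x x)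

lemma isUnit_det_frameMat {φ : OpenPartialHomeomorph M (EuclideanSpace ℝ (Fin n))}
    (hφ : φ ∈ atlas (EuclideanSpace ℝ (Fin n)) M) {x : M} (hx : x ∈ φ.source) :
    IsUnit (frameMat φ x).det :=
  isUnit_det_transMat hφ (chart_mem_atlas _ x) hx (mem_chart_source _ x)

lemma pd_eq_changeFrame {φ : OpenPartialHomeomorph M (EuclideanSpace ℝ (Fin n))}
    (hφ : φ ∈ atlas (EuclideanSpace ℝ (Fin n)) M) {G : M → V} {x : M} (hx : x ∈ φ.source)
    (hG : ContMDiffAt (𝓡 n) 𝓘(ℝ, V) ∞ G x) :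
    pd G x = changeFrame (frameMat φ x) (cpd φ G (φ x)) := by
  rw [pd_eq_cpd hG]
  exact cpd_changeFrame hφ (chart_mem_atlas _ x) hx (mem_chart_source _ x) hG

lemma pd_congr {G G' : M → V} {x : M} (h : G =ᶠ[𝓝 x] G') : pd (n := n) G x = pd (n := n) G' x := by
  funext i
  rw [pd, pd, h.mfderiv_eq]
  rfl

lemma cpd_of_hasFDerivAt {φ : OpenPartialHomeomorph M (EuclideanSpace ℝ (Fin n))} {G : M → V}
    {y : EuclideanSpace ℝ (Fin n)} {L : EuclideanSpace ℝ (Fin n) →L[ℝ] V} (h : HasFDerivAt (G ∘ φ.symm) L y) (i : Fin n) :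
    cpd φ G y i = L (EuclideanSpace.single i 1) := by
  rw [cpd, h.fderiv]

lemma hasFDerivAt_chartAt {G : M → V} {x : M} (hG : ContMDiffAt (𝓡 n) 𝓘(ℝ, V) ∞ G x) :
    HasFDerivAt (G ∘ (chartAt (EuclideanSpace ℝ (Fin n)) x).symm)
      (fderiv ℝ (G ∘ (chartAt (EuclideanSpace ℝ (Fin n)) x).symm)
        (chartAt (EuclideanSpace ℝ (Fin n)) x x)) (chartAt (EuclideanSpace ℝ (Fin n)) x x) := by
  refine hasFDerivAt_comp_symm (chart_mem_atlas _ x) (mem_chart_target _ x) ?_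
  rwa [OpenPartialHomeomorph.left_inv _ (mem_chart_source _ x)]

/-- The route by which the product and chain rules for `pd` below reduce to Fréchet derivatives in
the preferred chart. -/
lemma pd_of_hasFDerivAt {G : M → V} {x : M} (hG : ContMDiffAt (𝓡 n) 𝓘(ℝ, V) ∞ G x)
    {L : EuclideanSpace ℝ (Fin n) →L[ℝ] V}
    (h : HasFDerivAt (G ∘ (chartAt (EuclideanSpace ℝ (Fin n)) x).symm) L
      (chartAt (EuclideanSpace ℝ (Fin n)) x x)) (i : Fin n) :
    pd G x i = L (EuclideanSpace.single i 1) := by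
  rw [pd_eq_cpd hG, cpd_of_hasFDerivAt h]

lemma pd_smul {u : M → ℝ} {G : M → V} {x : M} (hu : ContMDiffAt (𝓡 n) 𝓘(ℝ, ℝ) ∞ u x)
    (hG : ContMDiffAt (𝓡 n) 𝓘(ℝ, V) ∞ G x) (i : Fin n) :
    pd (fun z => u z • G z) x i = u x • pd G x i + pd u x i • G x := by
  rw [pd_eq_cpd hu, pd_eq_cpd hG, pd_of_hasFDerivAt (G := fun z => u z • G z) (hu.smul hG)
    ((hasFDerivAt_chartAt hu).smul (hasFDerivAt_chartAt hG))]
  simp [cpd, OpenPartialHomeomorph.left_inv _ (mem_chart_source _ x)]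

lemma pd_add {G G' : M → V} {x : M} (hG : ContMDiffAt (𝓡 n) 𝓘(ℝ, V) ∞ G x)
    (hG' : ContMDiffAt (𝓡 n) 𝓘(ℝ, V) ∞ G' x) (i : Fin n) :
    pd (fun z => G z + G' z) x i = pd G x i + pd G' x i := by
  rw [pd_eq_cpd hG, pd_eq_cpd hG', pd_of_hasFDerivAt (G := fun z => G z + G' z) (hG.add hG')
    ((hasFDerivAt_chartAt hG).add (hasFDerivAt_chartAt hG'))]
  simp [cpd]

lemma pd_clm (L : V →L[ℝ] W) {G : M → V} {x : M} (hG : ContMDiffAt (𝓡 n) 𝓘(ℝ, V) ∞ G x)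
    (i : Fin n) : pd (fun z => L (G z)) x i = L (pd G x i) := by
  rw [pd_eq_cpd hG, pd_of_hasFDerivAt (G := fun z => L (G z))
    (L.contMDiff.contMDiffAt.comp x hG) (L.hasFDerivAt.comp _ (hasFDerivAt_chartAt hG))]
  simp [cpd]

lemma contMDiffAt_inner {W : Type*} [NormedAddCommGroup W] [InnerProductSpace ℝ W] {G G' : M → W}
    {x : M} (hG : ContMDiffAt (𝓡 n) 𝓘(ℝ, W) ∞ G x) (hG' : ContMDiffAt (𝓡 n) 𝓘(ℝ, W) ∞ G' x) :
    ContMDiffAt (𝓡 n) 𝓘(ℝ, ℝ) ∞ (fun z => (inner ℝ (G z) (G' z) : ℝ)) x :=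
  (contDiff_inner (𝕜 := ℝ) (E := W)).contMDiff.contMDiffAt.comp x (hG.prodMk_space hG')

lemma pd_inner {W : Type*} [NormedAddCommGroup W] [InnerProductSpace ℝ W] {G G' : M → W}
    {x : M} (hG : ContMDiffAt (𝓡 n) 𝓘(ℝ, W) ∞ G x) (hG' : ContMDiffAt (𝓡 n) 𝓘(ℝ, W) ∞ G' x)
    (i : Fin n) : pd (fun z => (inner ℝ (G z) (G' z) : ℝ)) x i =
      inner ℝ (G x) (pd G' x i) + inner ℝ (pd G x i) (G' x) := by
  rw [pd_eq_cpd hG, pd_eq_cpd hG', pd_of_hasFDerivAt (contMDiffAt_inner hG hG')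
    ((hasFDerivAt_chartAt hG).inner ℝ (hasFDerivAt_chartAt hG'))]
  simp [cpd, OpenPartialHomeomorph.left_inv _ (mem_chart_source _ x)]

lemma contMDiffAt_exp_neg {u : M → ℝ} {x : M} (hu : ContMDiffAt (𝓡 n) 𝓘(ℝ, ℝ) ∞ u x) :
    ContMDiffAt (𝓡 n) 𝓘(ℝ, ℝ) ∞ (fun z => Real.exp (-u z)) x :=
  (Real.contDiff_exp.comp contDiff_neg).contMDiff.contMDiffAt.comp x hu

lemma pd_exp_neg {u : M → ℝ} {x : M} (hu : ContMDiffAt (𝓡 n) 𝓘(ℝ, ℝ) ∞ u x) (i : Fin n) :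
    pd (fun z => Real.exp (-u z)) x i = -(Real.exp (-u x) * pd u x i) := by
  rw [pd_eq_cpd hu, pd_of_hasFDerivAt (contMDiffAt_exp_neg hu)
    (hasFDerivAt_chartAt hu).neg.exp]
  simp [cpd, OpenPartialHomeomorph.left_inv _ (mem_chart_source _ x)]

lemma height_eq_inner (F : M → Amb n) (x : M) : height F x = inner ℝ (eLast n) (F x) := by
  simp [height, eLast, EuclideanSpace.inner_single_left]

lemma pd_height {F : M → Amb n} {x : M} (hF : ContMDiffAt (𝓡 n) 𝓘(ℝ, Amb n) ∞ F x)
    (i : Fin n) : pd (height F) x i = inner ℝ (eLast n) (pd F x i) := by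
  have : height F = fun z => innerSL ℝ (eLast n) (F z) := by
    funext z; rw [height_eq_inner]; rfl
  rw [this, pd_clm _ hF]; rfl

lemma contMDiffAt_height {F : M → Amb n} {x : M} (hF : ContMDiffAt (𝓡 n) 𝓘(ℝ, Amb n) ∞ F x) :
    ContMDiffAt (𝓡 n) 𝓘(ℝ, ℝ) ∞ (height F) x := by
  have : height F = fun z => innerSL ℝ (eLast n) (F z) := by
    funext z; rw [height_eq_inner]; rfl
  rw [this]
  exact (innerSL ℝ (eLast n)).contMDiff.contMDiffAt.comp x hF

lemma pd_const (c : V) (x : M) (i : Fin n) : pd (fun _ : M => c) x i = 0 := by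
  simp only [pd, mfderiv_const]; rfl

lemma surfaceDiv_eq_frameDiv (F G : M → Amb n) (x : M) :
    surfaceDiv F G x = frameDiv (pd (n := n) F x) (pd G x) := rfl

lemma grad_eq_frameGrad (F : M → Amb n) (u : M → ℝ) (x : M) :
    grad F u x = frameGrad (pd (n := n) F x) (pd u x) := rfl

lemma metric_eq_gram (F : M → Amb n) (x : M) : metric F x = Matrix.gram ℝ (pd (n := n) F x) := rfl

lemma surfaceDiv_eq_cpd {φ : OpenPartialHomeomorph M (EuclideanSpace ℝ (Fin n))}
    (hφ : φ ∈ atlas (EuclideanSpace ℝ (Fin n)) M) {F G : M → Amb n} {x : M} (hx : x ∈ φ.source)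
    (hF : ContMDiffAt (𝓡 n) 𝓘(ℝ, Amb n) ∞ F x) (hG : ContMDiffAt (𝓡 n) 𝓘(ℝ, Amb n) ∞ G x) :
    surfaceDiv F G x = frameDiv (cpd φ F (φ x)) (cpd φ G (φ x)) := by
  rw [surfaceDiv_eq_frameDiv, pd_eq_changeFrame hφ hx hF, pd_eq_changeFrame hφ hx hG,
    frameDiv_changeFrame (isUnit_det_frameMat hφ hx)]

lemma det_metric_eq_cpd {φ : OpenPartialHomeomorph M (EuclideanSpace ℝ (Fin n))}
    (hφ : φ ∈ atlas (EuclideanSpace ℝ (Fin n)) M) {F : M → Amb n} {x : M} (hx : x ∈ φ.source)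
    (hF : ContMDiffAt (𝓡 n) 𝓘(ℝ, Amb n) ∞ F x) :
    (metric F x).det = (frameMat φ x).det ^ 2 * (Matrix.gram ℝ (cpd φ F (φ x))).det := by
  rw [metric_eq_gram, pd_eq_changeFrame hφ hx hF, det_gram_changeFrame]

lemma chartDensity_eq (F : M → Amb n) (φ : OpenPartialHomeomorph M (EuclideanSpace ℝ (Fin n)))
    (y : EuclideanSpace ℝ (Fin n)) :
    chartDensity F φ y = √(Matrix.gram ℝ (cpd φ F y)).det := rfl

/-- An injective differential carries the standard basis to an independent family, and independence
is equivalent to a nonzero Gram determinant. This is the form in which the immersion hypothesis is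
used throughout. -/
lemma det_metric_ne_zero {F : M → Amb n} {x : M}
    (h : Function.Injective (mfderiv (𝓡 n) 𝓘(ℝ, Amb n) F x)) : (metric F x).det ≠ 0 := by
  rw [metric_eq_gram, Matrix.det_gram_ne_zero_iff_linearIndependent]
  let b : Module.Basis (Fin n) ℝ (EuclideanSpace ℝ (Fin n)) :=
    (EuclideanSpace.basisFun (Fin n) ℝ).toBasis
  let L : EuclideanSpace ℝ (Fin n) →ₗ[ℝ] Amb n :=
    (mfderiv (𝓡 n) 𝓘(ℝ, Amb n) F x).toLinearMap
  have h1 := b.linearIndependent.map' L (LinearMap.ker_eq_bot.2 h)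
  have h2 : pd F x = L ∘ b := by
    funext i
    simp only [Function.comp_apply, b, L, pd, OrthonormalBasis.coe_toBasis,
      EuclideanSpace.basisFun_apply]
    rfl
  rw [h2]
  exact h1

lemma det_cpd_ne_zero {φ : OpenPartialHomeomorph M (EuclideanSpace ℝ (Fin n))}
    (hφ : φ ∈ atlas (EuclideanSpace ℝ (Fin n)) M) {F : M → Amb n} {x : M} (hx : x ∈ φ.source)
    (hF : ContMDiffAt (𝓡 n) 𝓘(ℝ, Amb n) ∞ F x) (h : (metric F x).det ≠ 0) :
    (Matrix.gram ℝ (cpd φ F (φ x))).det ≠ 0 := by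
  rw [det_metric_eq_cpd hφ hx hF] at h
  exact right_ne_zero_of_mul h

end Charts
-- Smoothness of the divergence, the gradient and the relative Jacobian.
section Smoothness

variable {n : ℕ} {M : Type*} [TopologicalSpace M] [ChartedSpace (EuclideanSpace ℝ (Fin n)) M]
  [IsManifold (𝓡 n) ∞ M]
variable {X : Type*} [NormedAddCommGroup X] [NormedSpace ℝ X]

lemma contDiffOn_crossGram {s : Set X} {P Q : X → Fin n → Amb n}
    (hP : ∀ i, ContDiffOn ℝ ∞ (fun y => P y i) s) (hQ : ∀ i, ContDiffOn ℝ ∞ (fun y => Q y i) s)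
    (i j : Fin n) : ContDiffOn ℝ ∞ (fun y => crossGram (P y) (Q y) i j) s :=
  (hQ i).inner ℝ (hP j)

lemma contDiffOn_det {s : Set X} {A : X → Matrix (Fin n) (Fin n) ℝ}
    (hA : ∀ i j, ContDiffOn ℝ ∞ (fun y => A y i j) s) : ContDiffOn ℝ ∞ (fun y => (A y).det) s := by
  simp only [Matrix.det_apply']
  exact ContDiffOn.sum fun σ _ => contDiffOn_const.mul (contDiffOn_prod fun i _ => hA _ _)

/-- By Cramer's rule each entry of the inverse is a quotient of determinants, hence of polynomials
in the entries. -/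
lemma contDiffOn_matrix_inv {s : Set X} {A : X → Matrix (Fin n) (Fin n) ℝ}
    (hA : ∀ i j, ContDiffOn ℝ ∞ (fun y => A y i j) s) (hdet : ∀ y ∈ s, (A y).det ≠ 0)
    (i j : Fin n) : ContDiffOn ℝ ∞ (fun y => (A y)⁻¹ i j) s := by
  have h1 : (fun y => (A y)⁻¹ i j) =
      fun y => (A y).det⁻¹ * ((A y).updateRow j (Pi.single i 1)).det := by
    funext y
    rw [Matrix.inv_def, Matrix.smul_apply, Matrix.adjugate_apply, Ring.inverse_eq_inv', smul_eq_mul]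
  rw [h1]
  refine ((contDiffOn_det hA).inv hdet).mul (contDiffOn_det fun k l => ?_)
  simp only [Matrix.updateRow_apply]
  split_ifs
  · exact contDiffOn_const
  · exact hA k l

lemma contDiffOn_frameDiv {s : Set X} {P Q : X → Fin n → Amb n}
    (hP : ∀ i, ContDiffOn ℝ ∞ (fun y => P y i) s) (hQ : ∀ i, ContDiffOn ℝ ∞ (fun y => Q y i) s)
    (hdet : ∀ y ∈ s, (Matrix.gram ℝ (P y)).det ≠ 0) :
    ContDiffOn ℝ ∞ (fun y => frameDiv (P y) (Q y)) s :=
  ContDiffOn.sum fun i _ => ContDiffOn.sum fun j _ =>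
    (contDiffOn_matrix_inv (contDiffOn_crossGram hP hP) hdet i j).mul ((hQ i).inner ℝ (hP j))

lemma contDiffOn_frameGrad {s : Set X} {P : X → Fin n → Amb n} {a : X → Fin n → ℝ}
    (hP : ∀ i, ContDiffOn ℝ ∞ (fun y => P y i) s) (ha : ∀ i, ContDiffOn ℝ ∞ (fun y => a y i) s)
    (hdet : ∀ y ∈ s, (Matrix.gram ℝ (P y)).det ≠ 0) :
    ContDiffOn ℝ ∞ (fun y => frameGrad (P y) (a y)) s :=
  ContDiffOn.sum fun i _ => ContDiffOn.sum fun j _ =>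
    ((contDiffOn_matrix_inv (contDiffOn_crossGram hP hP) hdet i j).mul (ha i)).smul (hP j)

lemma contDiffOn_cpd {V : Type*} [NormedAddCommGroup V] [NormedSpace ℝ V]
    {φ : OpenPartialHomeomorph M (EuclideanSpace ℝ (Fin n))}
    (hφ : φ ∈ atlas (EuclideanSpace ℝ (Fin n)) M) {G : M → V}
    (hG : ContMDiff (𝓡 n) 𝓘(ℝ, V) ∞ G) (i : Fin n) :
    ContDiffOn ℝ ∞ (fun y => cpd φ G y i) φ.target :=
  ((contDiffOn_comp_symm hφ hG).fderiv_of_isOpen φ.open_target (m := ∞) (by simp)).clm_apply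
    contDiffOn_const

variable {F : M → Amb n}

lemma det_gram_cpd_ne_zero {φ : OpenPartialHomeomorph M (EuclideanSpace ℝ (Fin n))}
    (hφ : φ ∈ atlas (EuclideanSpace ℝ (Fin n)) M) (hF : ContMDiff (𝓡 n) 𝓘(ℝ, Amb n) ∞ F)
    (himm : ∀ x, (metric F x).det ≠ 0) {y : EuclideanSpace ℝ (Fin n)} (hy : y ∈ φ.target) :
    (Matrix.gram ℝ (cpd φ F y)).det ≠ 0 := by
  have := det_cpd_ne_zero hφ (φ.map_target hy) (hF _) (himm _)
  rwa [φ.right_inv hy] at this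

/-- The definition uses a chart that varies with the point, which hides smoothness; by frame
invariance it may be computed near x in the single chart at x. -/
lemma contMDiff_surfaceDiv (hF : ContMDiff (𝓡 n) 𝓘(ℝ, Amb n) ∞ F)
    (himm : ∀ x, (metric F x).det ≠ 0) {G : M → Amb n} (hG : ContMDiff (𝓡 n) 𝓘(ℝ, Amb n) ∞ G) :
    ContMDiff (𝓡 n) 𝓘(ℝ, ℝ) ∞ (surfaceDiv F G) := by
  intro x
  set φ := chartAt (EuclideanSpace ℝ (Fin n)) x
  have hφ : φ ∈ atlas (EuclideanSpace ℝ (Fin n)) M := chart_mem_atlas _ x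
  have hy : φ.target ∈ 𝓝 (φ x) := φ.open_target.mem_nhds (mem_chart_target _ x)
  refine contMDiffAt_of_comp_symm hφ (mem_chart_source _ x) ?_
  refine ((contDiffOn_frameDiv (contDiffOn_cpd hφ hF) (contDiffOn_cpd hφ hG)
    fun y hy => det_gram_cpd_ne_zero hφ hF himm hy).contDiffAt hy).congr_of_eventuallyEq ?_
  filter_upwards [hy] with y hy
  rw [Function.comp_apply, surfaceDiv_eq_cpd hφ (φ.map_target hy) (hF _) (hG _), φ.right_inv hy]

lemma contMDiff_grad (hF : ContMDiff (𝓡 n) 𝓘(ℝ, Amb n) ∞ F)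
    (himm : ∀ x, (metric F x).det ≠ 0) {u : M → ℝ} (hu : ContMDiff (𝓡 n) 𝓘(ℝ, ℝ) ∞ u) :
    ContMDiff (𝓡 n) 𝓘(ℝ, Amb n) ∞ (grad F u) := by
  intro x
  set φ := chartAt (EuclideanSpace ℝ (Fin n)) x
  have hφ : φ ∈ atlas (EuclideanSpace ℝ (Fin n)) M := chart_mem_atlas _ x
  have hy : φ.target ∈ 𝓝 (φ x) := φ.open_target.mem_nhds (mem_chart_target _ x)
  refine contMDiffAt_of_comp_symm hφ (mem_chart_source _ x) ?_
  refine ((contDiffOn_frameGrad (contDiffOn_cpd hφ hF) (contDiffOn_cpd hφ hu)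
    fun y hy => det_gram_cpd_ne_zero hφ hF himm hy).contDiffAt hy).congr_of_eventuallyEq ?_
  filter_upwards [hy] with y hy
  rw [Function.comp_apply, grad_eq_frameGrad, pd_eq_changeFrame hφ (φ.map_target hy) (hF _),
    pd_eq_changeFrame hφ (φ.map_target hy) (hu _),
    frameGrad_changeFrame (isUnit_det_frameMat hφ (φ.map_target hy)), φ.right_inv hy]
  rw [φ.right_inv hy]
  exact det_gram_cpd_ne_zero hφ hF himm hy

/-- The squared Jacobian of `G` relative to `F`. -/
def sqJacobian (F G : M → Amb n) (x : M) : ℝ := (metric G x).det / (metric F x).det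

/-- Both Gram determinants scale by the same squared determinant, so the quotient does not depend on
the chart. -/
lemma sqJacobian_eq_cpd {φ : OpenPartialHomeomorph M (EuclideanSpace ℝ (Fin n))}
    (hφ : φ ∈ atlas (EuclideanSpace ℝ (Fin n)) M) {G : M → Amb n} {x : M} (hx : x ∈ φ.source)
    (hF : ContMDiffAt (𝓡 n) 𝓘(ℝ, Amb n) ∞ F x) (hG : ContMDiffAt (𝓡 n) 𝓘(ℝ, Amb n) ∞ G x) :
    sqJacobian F G x =
      (Matrix.gram ℝ (cpd φ G (φ x))).det / (Matrix.gram ℝ (cpd φ F (φ x))).det := by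
  rw [sqJacobian, det_metric_eq_cpd hφ hx hF, det_metric_eq_cpd hφ hx hG,
    mul_div_mul_left _ _ (pow_ne_zero _ (isUnit_det_frameMat hφ hx).ne_zero)]

lemma contMDiff_sqJacobian (hF : ContMDiff (𝓡 n) 𝓘(ℝ, Amb n) ∞ F)
    (himm : ∀ x, (metric F x).det ≠ 0) {G : M → Amb n} (hG : ContMDiff (𝓡 n) 𝓘(ℝ, Amb n) ∞ G) :
    ContMDiff (𝓡 n) 𝓘(ℝ, ℝ) ∞ (sqJacobian F G) := by
  intro x
  set φ := chartAt (EuclideanSpace ℝ (Fin n)) x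
  have hφ : φ ∈ atlas (EuclideanSpace ℝ (Fin n)) M := chart_mem_atlas _ x
  have hy : φ.target ∈ 𝓝 (φ x) := φ.open_target.mem_nhds (mem_chart_target _ x)
  refine contMDiffAt_of_comp_symm hφ (mem_chart_source _ x) ?_
  refine (((contDiffOn_det (contDiffOn_crossGram (contDiffOn_cpd hφ hG)
    (contDiffOn_cpd hφ hG))).div (contDiffOn_det (contDiffOn_crossGram (contDiffOn_cpd hφ hF)
    (contDiffOn_cpd hφ hF))) fun y hy => det_gram_cpd_ne_zero hφ hF himm hy).contDiffAt
      hy).congr_of_eventuallyEq ?_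
  filter_upwards [hy] with y hy
  rw [Function.comp_apply, sqJacobian_eq_cpd hφ (φ.map_target hy) (hF _) (hG _), φ.right_inv hy]
  rfl

end Smoothness

/-! ### The area measure: independence of charts, finiteness, positivity, relative density. -/

section Measure

open MeasureTheory

variable {n : ℕ} {M : Type*} [TopologicalSpace M] [ChartedSpace (EuclideanSpace ℝ (Fin n)) M]
  [IsManifold (𝓡 n) ∞ M] [MeasurableSpace M] [BorelSpace M] {F : M → Amb n}

lemma continuousOn_chartDensity {φ : OpenPartialHomeomorph M (EuclideanSpace ℝ (Fin n))}
    (hφ : φ ∈ atlas (EuclideanSpace ℝ (Fin n)) M) (hF : ContMDiff (𝓡 n) 𝓘(ℝ, Amb n) ∞ F) :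
    ContinuousOn (chartDensity F φ) φ.target :=
  (contDiffOn_det (contDiffOn_crossGram (contDiffOn_cpd hφ hF)
    (contDiffOn_cpd hφ hF))).continuousOn.sqrt

lemma aemeasurable_symm (φ : OpenPartialHomeomorph M (EuclideanSpace ℝ (Fin n))) :
    AEMeasurable φ.symm (volume.restrict φ.target) :=
  φ.continuousOn_symm.aemeasurable φ.open_target.measurableSet

lemma aemeasurable_chartDensity {φ : OpenPartialHomeomorph M (EuclideanSpace ℝ (Fin n))}
    (hφ : φ ∈ atlas (EuclideanSpace ℝ (Fin n)) M) (hF : ContMDiff (𝓡 n) 𝓘(ℝ, Amb n) ∞ F) :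
    AEMeasurable (fun y => ENNReal.ofReal (chartDensity F φ y)) (volume.restrict φ.target) :=
  ((continuousOn_chartDensity hφ hF).aemeasurable φ.open_target.measurableSet).ennreal_ofReal

lemma lintegral_chartArea {φ : OpenPartialHomeomorph M (EuclideanSpace ℝ (Fin n))}
    (hφ : φ ∈ atlas (EuclideanSpace ℝ (Fin n)) M) (hF : ContMDiff (𝓡 n) 𝓘(ℝ, Amb n) ∞ F)
    {h : M → ENNReal} (hh : Measurable h) :
    ∫⁻ x, h x ∂(chartArea F φ) =
      ∫⁻ y in φ.target, ENNReal.ofReal (chartDensity F φ y) * h (φ.symm y) := by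
  have h1 : AEMeasurable φ.symm ((volume.restrict φ.target).withDensity
      fun y => ENNReal.ofReal (chartDensity F φ y)) :=
    (aemeasurable_symm φ).mono_ac (withDensity_absolutelyContinuous _ _)
  rw [chartArea, lintegral_map' hh.aemeasurable h1]
  exact lintegral_withDensity_eq_lintegral_mul₀' (aemeasurable_chartDensity hφ hF)
    (hh.comp_aemeasurable h1)

lemma chartArea_apply (F : M → Amb n) (φ : OpenPartialHomeomorph M (EuclideanSpace ℝ (Fin n)))
    {S : Set M} (hS : MeasurableSet S) :
    chartArea F φ S =
      ∫⁻ y in φ.symm ⁻¹' S ∩ φ.target, ENNReal.ofReal (chartDensity F φ y) := by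
  have h1 : AEMeasurable φ.symm ((volume.restrict φ.target).withDensity
      fun y => ENNReal.ofReal (chartDensity F φ y)) :=
    (aemeasurable_symm φ).mono_ac (withDensity_absolutelyContinuous _ _)
  rw [chartArea, Measure.map_apply_of_aemeasurable h1 hS, withDensity_apply',
    Measure.restrict_restrict' φ.open_target.measurableSet]

lemma chartArea_inter_source (F : M → Amb n)
    (φ : OpenPartialHomeomorph M (EuclideanSpace ℝ (Fin n))) {S : Set M} (hS : MeasurableSet S) : chartArea F φ (S ∩ φ.source) = chartArea F φ S := by
  rw [chartArea_apply F _ hS, chartArea_apply F _ (hS.inter φ.open_source.measurableSet)]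
  congr 2
  ext y
  simp only [Set.mem_inter_iff, Set.mem_preimage]
  exact ⟨fun h => ⟨h.1.1, h.2⟩, fun h => ⟨⟨h.1, φ.map_target h.2⟩, h.2⟩⟩

lemma measurableSet_preimage_symm (φ : OpenPartialHomeomorph M (EuclideanSpace ℝ (Fin n)))
    {S : Set M} (hS : MeasurableSet S) : MeasurableSet (φ.symm ⁻¹' S ∩ φ.target) := by
  have h1 : MeasurableSet (φ.target.domRestrict φ.symm ⁻¹' S) :=
    (continuousOn_iff_continuous_domRestrict.1 φ.continuousOn_symm).measurable hS
  have h2 := φ.open_target.measurableSet.subtype_image h1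
  convert h2 using 1
  ext y
  simp [Set.domRestrict, and_comm]

/-- The change of variables formula. -/
lemma chartArea_eq_chartArea {φ ψ : OpenPartialHomeomorph M (EuclideanSpace ℝ (Fin n))}
    (hφ : φ ∈ atlas (EuclideanSpace ℝ (Fin n)) M) (hψ : ψ ∈ atlas (EuclideanSpace ℝ (Fin n)) M)
    (hF : ContMDiff (𝓡 n) 𝓘(ℝ, Amb n) ∞ F) {S : Set M} (hS : MeasurableSet S)
    (hSφ : S ⊆ φ.source) (hSψ : S ⊆ ψ.source) : chartArea F φ S = chartArea F ψ S := by
  rw [chartArea_apply F _ hS, chartArea_apply F _ hS]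
  -- The two coordinate images of S correspond under the transition map, which is the substitution
  -- in the integral.
  have himg : φ.symm ⁻¹' S ∩ φ.target = (φ ∘ ψ.symm) '' (ψ.symm ⁻¹' S ∩ ψ.target) := by
    ext y
    simp only [Set.mem_inter_iff, Set.mem_preimage, Set.mem_image, Function.comp_apply]
    constructor
    · rintro ⟨h1, h2⟩
      exact ⟨ψ (φ.symm y), ⟨by rwa [ψ.left_inv (hSψ h1)], ψ.map_source (hSψ h1)⟩, by
        rw [ψ.left_inv (hSψ h1), φ.right_inv h2]⟩
    · rintro ⟨z, ⟨h1, h2⟩, rfl⟩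
      exact ⟨by rwa [φ.left_inv (hSφ h1)], φ.map_source (hSφ h1)⟩
  rw [himg, lintegral_image_eq_lintegral_abs_det_fderiv_mul volume
    (measurableSet_preimage_symm ψ hS) (f' := fun y => fderiv ℝ (φ ∘ ψ.symm) y)]
  · refine setLIntegral_congr_fun (measurableSet_preimage_symm ψ hS) fun y hy => ?_
    obtain ⟨hy1, hy2⟩ := hy
    have hx := hSφ hy1
    have hx' := hSψ hy1
    have h1 := cpd_changeFrame hφ hψ hx hx' (hF (ψ.symm y))
    rw [ψ.right_inv hy2] at h1
    -- The density picks up √(det D)² = |det D|, which is exactly the Jacobian factor of the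
    -- substitution.
    rw [← ENNReal.ofReal_mul (abs_nonneg _), chartDensity_eq, chartDensity_eq, h1,
      det_gram_changeFrame, det_transMat, Real.sqrt_mul (sq_nonneg _), Real.sqrt_sq_eq_abs]
    rfl
  · rintro y ⟨hy1, hy2⟩
    refine (hasFDerivAt_comp_symm hψ hy2 ?_).hasFDerivWithinAt
    exact contMDiffAt_of_mem_maximalAtlas (IsManifold.subset_maximalAtlas hφ) (hSφ hy1)
  · rintro y ⟨hy1, hy2⟩ z ⟨hz1, hz2⟩ h
    have h2 : ψ.symm y = ψ.symm z := φ.injOn (hSφ hy1) (hSφ hz1) h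
    exact ψ.symm.injOn hy2 hz2 h2

lemma areaMeasure_apply {ψ : OpenPartialHomeomorph M (EuclideanSpace ℝ (Fin n))}
    (hψ : ψ ∈ atlas (EuclideanSpace ℝ (Fin n)) M) (hF : ContMDiff (𝓡 n) 𝓘(ℝ, Amb n) ∞ F)
    {S : Set M} (hS : MeasurableSet S) (hSψ : S ⊆ ψ.source) :
    areaMeasure F S = chartArea F ψ S := by
  refine le_antisymm ?_ ?_
  -- An upper bound for all chart measures at once: `chartArea F ψ` on the domain of ψ, and the
  -- largest measure `⊤` outside it. The second summand does not see S.
  · let κ : Measure M := chartArea F ψ + (⊤ : Measure M).restrict ψ.sourceᶜ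
    have hκ : areaMeasure F ≤ κ := by
      refine iSup₂_le fun φ hφ => Measure.le_iff.2 fun T hT => ?_
      have hm := ψ.open_source.measurableSet
      rw [← measure_inter_add_sdiff T hm]
      refine add_le_add ?_ ?_
      · rw [← chartArea_inter_source F _ (hT.inter hm),
          chartArea_eq_chartArea hφ hψ hF ((hT.inter hm).inter φ.open_source.measurableSet)
            Set.inter_subset_right (Set.inter_subset_left.trans Set.inter_subset_right)]
        exact measure_mono (Set.inter_subset_left.trans Set.inter_subset_left)
      · change _ ≤ ((⊤ : Measure M).restrict ψ.sourceᶜ) T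
        rw [Measure.restrict_apply hT, ← Set.sdiff_eq]
        exact (le_top : chartArea F φ ≤ ⊤) _
    refine (hκ S).trans ?_
    simp only [κ, Measure.add_apply]
    rw [Measure.restrict_apply hS, (Set.disjoint_compl_right_iff_subset.2 hSψ).inter_eq,
      measure_empty, add_zero]
  · exact (le_iSup₂ (f := fun φ (_ : φ ∈ atlas (EuclideanSpace ℝ (Fin n)) M) => chartArea F φ)
      ψ hψ) S

lemma restrict_areaMeasure {φ : OpenPartialHomeomorph M (EuclideanSpace ℝ (Fin n))}
    (hφ : φ ∈ atlas (EuclideanSpace ℝ (Fin n)) M) (hF : ContMDiff (𝓡 n) 𝓘(ℝ, Amb n) ∞ F) :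
    (areaMeasure F).restrict φ.source = chartArea F φ := by
  ext S hS
  rw [Measure.restrict_apply hS, areaMeasure_apply hφ hF (hS.inter φ.open_source.measurableSet)
    Set.inter_subset_right, chartArea_inter_source F _ hS]

/-- A coordinate ball whose closure lies in the chart has finite area, since the continuous density
is bounded on the compact closed ball. -/
lemma isLocallyFiniteMeasure_areaMeasure (hF : ContMDiff (𝓡 n) 𝓘(ℝ, Amb n) ∞ F) :
    IsLocallyFiniteMeasure (areaMeasure F) := by
  refine ⟨fun x => ?_⟩
  set φ := chartAt (EuclideanSpace ℝ (Fin n)) x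
  have hφ : φ ∈ atlas (EuclideanSpace ℝ (Fin n)) M := chart_mem_atlas _ x
  obtain ⟨r, hr, hball⟩ := Metric.nhds_basis_closedBall.mem_iff.1
    (φ.open_target.mem_nhds (mem_chart_target _ x))
  have hopen : IsOpen (φ.source ∩ φ ⁻¹' Metric.ball (φ x) r) :=
    φ.isOpen_inter_preimage Metric.isOpen_ball
  refine ⟨_, hopen.mem_nhds ⟨mem_chart_source _ x, Metric.mem_ball_self hr⟩, ?_⟩
  rw [areaMeasure_apply hφ hF hopen.measurableSet Set.inter_subset_left,
    chartArea_apply F _ hopen.measurableSet]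
  have hsub : φ.symm ⁻¹' (φ.source ∩ φ ⁻¹' Metric.ball (φ x) r) ∩ φ.target ⊆
      Metric.closedBall (φ x) r := by
    rintro y ⟨⟨-, hy⟩, hy'⟩
    rw [Set.mem_preimage, φ.right_inv hy'] at hy
    exact Metric.ball_subset_closedBall hy
  obtain ⟨C, hC⟩ := (isCompact_closedBall (φ x) r).bddAbove_image
    ((continuousOn_chartDensity hφ hF).mono hball)
  calc _ ≤ ∫⁻ y in Metric.closedBall (φ x) r, ENNReal.ofReal (chartDensity F φ y) :=
        lintegral_mono_set hsub
    _ ≤ ∫⁻ y in Metric.closedBall (φ x) r, ENNReal.ofReal C :=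
        setLIntegral_mono' measurableSet_closedBall fun y hy =>
          ENNReal.ofReal_le_ofReal (hC (Set.mem_image_of_mem _ hy))
    _ < ⊤ := by
        rw [setLIntegral_const]
        exact ENNReal.mul_lt_top ENNReal.ofReal_lt_top measure_closedBall_lt_top

lemma chartDensity_pos {φ : OpenPartialHomeomorph M (EuclideanSpace ℝ (Fin n))}
    (hφ : φ ∈ atlas (EuclideanSpace ℝ (Fin n)) M) (hF : ContMDiff (𝓡 n) 𝓘(ℝ, Amb n) ∞ F)
    (himm : ∀ x, (metric F x).det ≠ 0) {y : EuclideanSpace ℝ (Fin n)} (hy : y ∈ φ.target) :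
    0 < chartDensity F φ y := by
  rw [chartDensity_eq, Real.sqrt_pos]
  exact lt_of_le_of_ne (Matrix.posSemidef_gram ℝ _).det_nonneg
    (det_gram_cpd_ne_zero hφ hF himm hy).symm

/-- The chart density of an immersion is strictly positive. Needed to conclude that a nonnegative
continuous function with zero integral vanishes. -/
lemma isOpenPosMeasure_areaMeasure (hF : ContMDiff (𝓡 n) 𝓘(ℝ, Amb n) ∞ F)
    (himm : ∀ x, (metric F x).det ≠ 0) : (areaMeasure F).IsOpenPosMeasure := by
  refine ⟨fun U hU ⟨x, hx⟩ h0 => ?_⟩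
  set φ := chartAt (EuclideanSpace ℝ (Fin n)) x
  have hφ : φ ∈ atlas (EuclideanSpace ℝ (Fin n)) M := chart_mem_atlas _ x
  have hopen : IsOpen (U ∩ φ.source) := hU.inter φ.open_source
  have h1 : areaMeasure F (U ∩ φ.source) = 0 := measure_mono_null Set.inter_subset_left h0
  rw [areaMeasure_apply hφ hF hopen.measurableSet Set.inter_subset_right,
    chartArea_apply F _ hopen.measurableSet] at h1
  set A := φ.symm ⁻¹' (U ∩ φ.source) ∩ φ.target
  have hA : IsOpen A := by
    have := φ.symm.isOpen_inter_preimage hopen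
    rwa [Set.inter_comm] at this
  have hAx : φ x ∈ A := ⟨by
    rw [Set.mem_preimage, φ.left_inv (mem_chart_source _ x)]; exact ⟨hx, mem_chart_source _ x⟩,
    mem_chart_target _ x⟩
  have hmeas : AEMeasurable (fun y => ENNReal.ofReal (chartDensity F φ y)) (volume.restrict A) :=
    (aemeasurable_chartDensity hφ hF).mono_set Set.inter_subset_right
  rw [lintegral_eq_zero_iff' hmeas, Filter.EventuallyEq,
    ae_restrict_iff' hA.measurableSet] at h1
  have h2 : volume A = 0 := by
    refine measure_mono_null (fun y hy => ?_) h1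
    simp only [Set.mem_compl_iff, Set.mem_ofPred_eq, not_forall]
    exact ⟨hy, by simpa using chartDensity_pos hφ hF himm hy.2⟩
  exact hA.measure_ne_zero volume ⟨_, hAx⟩ h2

/-- Comparison of the area measures of two maps. -/
lemma areaMeasure_eq_withDensity [SecondCountableTopology M] {G : M → Amb n}
    (hF : ContMDiff (𝓡 n) 𝓘(ℝ, Amb n) ∞ F) (himm : ∀ x, (metric F x).det ≠ 0)
    (hG : ContMDiff (𝓡 n) 𝓘(ℝ, Amb n) ∞ G) :
    areaMeasure G =
      (areaMeasure F).withDensity fun x => ENNReal.ofReal √(sqJacobian F G x) := by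
  -- Second countability gives a countable cover by chart domains, on each of which the two measures
  -- can be compared in coordinates.
  obtain ⟨s, hs, hcover⟩ := TopologicalSpace.countable_cover_nhds
    fun x : M => chart_source_mem_nhds (EuclideanSpace ℝ (Fin n)) x
  have : Countable s := hs.to_subtype
  have hmeas : Measurable fun x => ENNReal.ofReal √(sqJacobian F G x) :=
    ((contMDiff_sqJacobian hF himm hG).continuous.sqrt.measurable).ennreal_ofReal
  refine Measure.ext_of_iUnion_eq_univ
    (s := fun x : s => (chartAt (EuclideanSpace ℝ (Fin n)) (x : M)).source)
    (by rw [← hcover, Set.biUnion_eq_iUnion]) fun x => ?_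
  set φ := chartAt (EuclideanSpace ℝ (Fin n)) (x : M)
  have hφ : φ ∈ atlas (EuclideanSpace ℝ (Fin n)) M := chart_mem_atlas _ _
  rw [restrict_withDensity φ.open_source.measurableSet, restrict_areaMeasure hφ hG,
    restrict_areaMeasure hφ hF]
  ext S hS
  rw [withDensity_apply _ hS, ← lintegral_indicator hS, ← lintegral_indicator_one hS,
    lintegral_chartArea hφ hF (hmeas.indicator hS),
    lintegral_chartArea hφ hG (measurable_one.indicator hS)]
  refine setLIntegral_congr_fun φ.open_target.measurableSet fun y hy => ?_
  by_cases hyS : φ.symm y ∈ S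
  · simp only [Set.indicator_of_mem hyS, Pi.one_apply, mul_one]
    rw [← ENNReal.ofReal_mul (chartDensity_pos hφ hF himm hy).le,
      sqJacobian_eq_cpd hφ (φ.map_target hy) (hF _) (hG _), φ.right_inv hy, chartDensity_eq,
      chartDensity_eq, Real.sqrt_div (Matrix.posSemidef_gram ℝ _).det_nonneg,
      mul_div_cancel₀]
    have := chartDensity_pos hφ hF himm hy
    exact this.ne'
  · simp [Set.indicator_of_notMem hyS]

end Measure
-- Traces of special families with respect to a frame.
section FrameTrace

variable {ι V : Type*} [Fintype ι] [DecidableEq ι] [NormedAddCommGroup V] [InnerProductSpace ℝ V]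

lemma frameDiv_add (P Q R : ι → V) :
    frameDiv P (fun i => Q i + R i) = frameDiv P Q + frameDiv P R := by
  simp only [frameDiv, inner_add_left, mul_add, Finset.sum_add_distrib]

lemma frameDiv_smul (P Q : ι → V) (c : ℝ) :
    frameDiv P (fun i => c • Q i) = c * frameDiv P Q := by
  simp only [frameDiv, real_inner_smul_left, Finset.mul_sum]
  exact Finset.sum_congr rfl fun i _ => Finset.sum_congr rfl fun j _ => by ring

lemma frameDiv_sum {κ : Type*} (s : Finset κ) (P : ι → V) (Q : κ → ι → V) :
    frameDiv P (fun i => ∑ k ∈ s, Q k i) = ∑ k ∈ s, frameDiv P (Q k) := by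
  simp only [frameDiv, sum_inner, Finset.mul_sum]
  conv_rhs => rw [Finset.sum_comm]
  refine Finset.sum_congr rfl fun i _ => ?_
  rw [Finset.sum_comm]

/-- The metric contracts with its inverse and leaves the ordinary trace of the coefficients. -/
lemma frameDiv_tangent {P : ι → V} (hP : (Matrix.gram ℝ P).det ≠ 0) (a : ι → ι → ℝ) :
    frameDiv P (fun i => ∑ j, a i j • P j) = ∑ i, a i i := by
  simp only [frameDiv, sum_inner, real_inner_smul_left, Finset.mul_sum]
  refine Finset.sum_congr rfl fun i _ => ?_
  rw [Finset.sum_comm]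
  calc _ = ∑ j, a i j * ∑ k, inner ℝ (P j) (P k) * (Matrix.gram ℝ P)⁻¹ k i := by
        refine Finset.sum_congr rfl fun j _ => ?_
        rw [Finset.mul_sum]
        refine Finset.sum_congr rfl fun k _ => ?_
        rw [gram_inv_symm]; ring
    _ = a i i := by simp [sum_gram_mul_inv hP]

lemma frameDiv_tangent_mul (P : ι → V) (a : ι → ℝ) (v : V) :
    frameDiv P (fun i => a i • v) = inner ℝ v (frameGrad P a) := by
  simp only [frameDiv, real_inner_smul_left, inner_eq_sum_frameGrad, mul_assoc]

end FrameTrace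

/-! ### The divergence theorem for compactly supported tangential fields. -/

section Divergence

open MeasureTheory

variable {n : ℕ} {M : Type*} [TopologicalSpace M] [ChartedSpace (EuclideanSpace ℝ (Fin n)) M]
  [IsManifold (𝓡 n) ∞ M] {F W : M → Amb n}

/-- The components of the tangential part of `W` in the coordinate frame. -/
def tangentCoeff (F W : M → Amb n) (φ : OpenPartialHomeomorph M (EuclideanSpace ℝ (Fin n)))
    (y : EuclideanSpace ℝ (Fin n)) (j : Fin n) : ℝ :=
  ∑ i, (Matrix.gram ℝ (cpd φ F y))⁻¹ i j * inner ℝ (W (φ.symm y)) (cpd φ F y i)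

lemma contDiffOn_tangentCoeff {φ : OpenPartialHomeomorph M (EuclideanSpace ℝ (Fin n))}
    (hφ : φ ∈ atlas (EuclideanSpace ℝ (Fin n)) M) (hF : ContMDiff (𝓡 n) 𝓘(ℝ, Amb n) ∞ F)
    (himm : ∀ x, (metric F x).det ≠ 0) (hW : ContMDiff (𝓡 n) 𝓘(ℝ, Amb n) ∞ W) (j : Fin n) :
    ContDiffOn ℝ ∞ (fun y => tangentCoeff F W φ y j) φ.target :=
  ContDiffOn.sum fun i _ => (contDiffOn_matrix_inv
    (contDiffOn_crossGram (contDiffOn_cpd hφ hF) (contDiffOn_cpd hφ hF))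
    (fun _ hy => det_gram_cpd_ne_zero hφ hF himm hy) i j).mul
    ((contDiffOn_comp_symm hφ hW).inner ℝ (contDiffOn_cpd hφ hF i))

lemma contDiffOn_chartDensity {φ : OpenPartialHomeomorph M (EuclideanSpace ℝ (Fin n))}
    (hφ : φ ∈ atlas (EuclideanSpace ℝ (Fin n)) M) (hF : ContMDiff (𝓡 n) 𝓘(ℝ, Amb n) ∞ F)
    (himm : ∀ x, (metric F x).det ≠ 0) : ContDiffOn ℝ ∞ (chartDensity F φ) φ.target :=
  (contDiffOn_det (contDiffOn_crossGram (contDiffOn_cpd hφ hF) (contDiffOn_cpd hφ hF))).sqrt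
    fun _ hy => det_gram_cpd_ne_zero hφ hF himm hy

lemma mem_span_cpd {φ : OpenPartialHomeomorph M (EuclideanSpace ℝ (Fin n))}
    (hφ : φ ∈ atlas (EuclideanSpace ℝ (Fin n)) M) {x : M} (hx : x ∈ φ.source)
    (hF : ContMDiffAt (𝓡 n) 𝓘(ℝ, Amb n) ∞ F x) {v : Amb n}
    (hv : v ∈ Submodule.span ℝ (Set.range (pd (n := n) F x))) :
    v ∈ Submodule.span ℝ (Set.range (cpd φ F (φ x))) := by
  rwa [pd_eq_changeFrame hφ hx hF, span_changeFrame (isUnit_det_frameMat hφ hx)] at hv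

lemma eq_sum_tangentCoeff {φ : OpenPartialHomeomorph M (EuclideanSpace ℝ (Fin n))}
    (hφ : φ ∈ atlas (EuclideanSpace ℝ (Fin n)) M) (hF : ContMDiff (𝓡 n) 𝓘(ℝ, Amb n) ∞ F)
    (himm : ∀ x, (metric F x).det ≠ 0)
    (htan : ∀ x, W x ∈ Submodule.span ℝ (Set.range (pd (n := n) F x)))
    {y : EuclideanSpace ℝ (Fin n)} (hy : y ∈ φ.target) :
    W (φ.symm y) = ∑ j, tangentCoeff F W φ y j • cpd φ F y j := by
  have h1 := mem_span_cpd hφ (φ.map_target hy) (hF _) (htan (φ.symm y))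
  rw [φ.right_inv hy] at h1
  rw [eq_frameGrad (det_gram_cpd_ne_zero hφ hF himm hy) h1, frameGrad, Finset.sum_comm]
  refine Finset.sum_congr rfl fun j _ => ?_
  rw [tangentCoeff, Finset.sum_smul]

/-- The partial derivative of `∂ᵢF` in the direction `k`. -/
def cpd₂ (φ : OpenPartialHomeomorph M (EuclideanSpace ℝ (Fin n))) (F : M → Amb n)
    (y : EuclideanSpace ℝ (Fin n)) (k i : Fin n) : Amb n :=
  fderiv ℝ (fun z => cpd φ F z i) y (EuclideanSpace.single k 1)

lemma cpd₂_symm {φ : OpenPartialHomeomorph M (EuclideanSpace ℝ (Fin n))}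
    (hφ : φ ∈ atlas (EuclideanSpace ℝ (Fin n)) M) {y : EuclideanSpace ℝ (Fin n)}
    (hy : y ∈ φ.target) (hF : ContMDiffAt (𝓡 n) 𝓘(ℝ, Amb n) ∞ F (φ.symm y)) (k i : Fin n) :
    cpd₂ φ F y k i = cpd₂ φ F y i k := by
  have h1 := contDiffAt_comp_symm hφ hy hF
  have h2 := h1.isSymmSndFDerivAt (by
    rw [minSmoothness_of_isRCLikeNormedField]; exact WithTop.coe_le_coe.2 (le_top : (2 : ℕ∞) ≤ ⊤))
  have h3 : DifferentiableAt ℝ (fderiv ℝ (F ∘ φ.symm)) y :=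
    (h1.fderiv_right (m := ∞) (by simp)).differentiableAt (by simp)
  have h4 : ∀ k i, cpd₂ φ F y k i = fderiv ℝ (fderiv ℝ (F ∘ φ.symm)) y
      (EuclideanSpace.single k 1) (EuclideanSpace.single i 1) := by
    intro k i
    simp only [cpd₂, cpd]
    rw [fderiv_clm_apply h3 (differentiableAt_const _)]
    simp
  rw [h4, h4]
  exact h2 _ _

/-- The first variation of the area density of a frame, with the coordinate y_k in the role of time:
the frame ∂_iF moves with velocity ∂_k∂_iF. -/
lemma fderiv_chartDensity {φ : OpenPartialHomeomorph M (EuclideanSpace ℝ (Fin n))}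
    (hφ : φ ∈ atlas (EuclideanSpace ℝ (Fin n)) M) (hF : ContMDiff (𝓡 n) 𝓘(ℝ, Amb n) ∞ F)
    (himm : ∀ x, (metric F x).det ≠ 0) {y : EuclideanSpace ℝ (Fin n)} (hy : y ∈ φ.target)
    (k : Fin n) : fderiv ℝ (chartDensity F φ) y (EuclideanSpace.single k 1) =
      chartDensity F φ y * frameDiv (cpd φ F y) (cpd₂ φ F y k) := by
  have hnhds := φ.open_target.mem_nhds hy
  have hline : HasDerivAt (fun t : ℝ => y + t • EuclideanSpace.single k (1 : ℝ))
      (EuclideanSpace.single k 1) 0 := by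
    simpa using ((hasDerivAt_id (0 : ℝ)).smul_const (EuclideanSpace.single k (1 : ℝ))).const_add y
  have hy0 : y + (0 : ℝ) • EuclideanSpace.single k (1 : ℝ) = y := by simp
  have hP : ∀ i, HasDerivAt (fun t : ℝ => cpd φ F (y + t • EuclideanSpace.single k (1 : ℝ)) i)
      (cpd₂ φ F y k i) 0 := by
    intro i
    have h1 : HasFDerivAt (fun z => cpd φ F z i) (fderiv ℝ (fun z => cpd φ F z i) y)
        (y + (0 : ℝ) • EuclideanSpace.single k (1 : ℝ)) := by
      rw [hy0]
      exact (((contDiffOn_cpd hφ hF i).contDiffAt hnhds).differentiableAt (by simp)).hasFDerivAt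
    exact h1.comp_hasDerivAt 0 hline
  have h1 := hasDerivAt_sqrt_det_gram hP
    (by rw [hy0]; exact det_gram_cpd_ne_zero hφ hF himm hy)
  rw [hy0] at h1
  have h2 : HasFDerivAt (chartDensity F φ) (fderiv ℝ (chartDensity F φ) y)
      (y + (0 : ℝ) • EuclideanSpace.single k (1 : ℝ)) := by
    rw [hy0]
    exact (((contDiffOn_chartDensity hφ hF himm).contDiffAt hnhds).differentiableAt
      (by simp)).hasFDerivAt
  have h3 : HasDerivAt (chartDensity F φ ∘ fun t : ℝ => y + t • EuclideanSpace.single k (1 : ℝ))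
      (chartDensity F φ y * frameDiv (cpd φ F y) (cpd₂ φ F y k)) 0 := h1
  exact (h2.comp_hasDerivAt 0 hline).unique h3

/-- The divergence of a tangential field in coordinates. -/
lemma sum_fderiv_density_mul_tangentCoeff
    {φ : OpenPartialHomeomorph M (EuclideanSpace ℝ (Fin n))}
    (hφ : φ ∈ atlas (EuclideanSpace ℝ (Fin n)) M) (hF : ContMDiff (𝓡 n) 𝓘(ℝ, Amb n) ∞ F)
    (himm : ∀ x, (metric F x).det ≠ 0) (hW : ContMDiff (𝓡 n) 𝓘(ℝ, Amb n) ∞ W)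
    (htan : ∀ x, W x ∈ Submodule.span ℝ (Set.range (pd (n := n) F x)))
    {y : EuclideanSpace ℝ (Fin n)} (hy : y ∈ φ.target) :
    ∑ k, fderiv ℝ (fun z => chartDensity F φ z * tangentCoeff F W φ z k) y
      (EuclideanSpace.single k 1) = chartDensity F φ y * surfaceDiv F W (φ.symm y) := by
  have hnhds := φ.open_target.mem_nhds hy
  have hd : DifferentiableAt ℝ (chartDensity F φ) y :=
    ((contDiffOn_chartDensity hφ hF himm).contDiffAt hnhds).differentiableAt (by simp)
  have hw : ∀ k, DifferentiableAt ℝ (fun z => tangentCoeff F W φ z k) y := fun k =>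
    ((contDiffOn_tangentCoeff hφ hF himm hW k).contDiffAt hnhds).differentiableAt (by simp)
  have hP : ∀ k, DifferentiableAt ℝ (fun z => cpd φ F z k) y := fun k =>
    ((contDiffOn_cpd hφ hF k).contDiffAt hnhds).differentiableAt (by simp)
  -- Differentiate W = wʲ∂_jF and use ∂_i∂_jF = ∂_j∂_iF. Taking the trace, the first sum gives ∂_k
  -- wᵏ and the second gives wᵏ ∂_k log √g, so that √g div W = ∂_k(√g wᵏ).
  have hWd : ∀ i, cpd φ W y i = (∑ j, fderiv ℝ (fun z => tangentCoeff F W φ z j) y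
      (EuclideanSpace.single i 1) • cpd φ F y j) +
      ∑ j, tangentCoeff F W φ y j • cpd₂ φ F y j i := by
    intro i
    have h1 : HasFDerivAt (fun z => ∑ j, tangentCoeff F W φ z j • cpd φ F z j)
        (∑ j, (tangentCoeff F W φ y j • fderiv ℝ (fun z => cpd φ F z j) y +
          (fderiv ℝ (fun z => tangentCoeff F W φ z j) y).smulRight (cpd φ F y j))) y :=
      HasFDerivAt.fun_sum fun j _ => (hw j).hasFDerivAt.smul (hP j).hasFDerivAt
    have h2 : (W ∘ φ.symm) =ᶠ[𝓝 y] fun z => ∑ j, tangentCoeff F W φ z j • cpd φ F z j := by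
      filter_upwards [hnhds] with z hz using eq_sum_tangentCoeff hφ hF himm htan hz
    rw [cpd_of_hasFDerivAt (h1.congr_of_eventuallyEq h2)]
    simp only [_root_.sum_apply, _root_.add_apply,
      _root_.smul_apply, ContinuousLinearMap.smulRight_apply,
      Finset.sum_add_distrib]
    rw [add_comm]
    congr 1
    refine Finset.sum_congr rfl fun j _ => ?_
    rw [cpd₂_symm hφ hy (hF _) j i]
    rfl
  rw [surfaceDiv_eq_cpd hφ (φ.map_target hy) (hF _) (hW _), φ.right_inv hy,
    show cpd φ W y = _ from funext hWd, frameDiv_add,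
    frameDiv_tangent (det_gram_cpd_ne_zero hφ hF himm hy),
    frameDiv_sum Finset.univ (cpd φ F y) fun j i => tangentCoeff F W φ y j • cpd₂ φ F y j i,
    ← Finset.sum_add_distrib, Finset.mul_sum]
  refine Finset.sum_congr rfl fun k _ => ?_
  rw [frameDiv_smul, fderiv_fun_mul hd (hw k)]
  simp only [_root_.add_apply, _root_.smul_apply, smul_eq_mul]
  rw [fderiv_chartDensity hφ hF himm hy]
  ring

lemma integral_fderiv_eq_zero {Q : EuclideanSpace ℝ (Fin n) → ℝ} (hQ : ContDiff ℝ ∞ Q)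
    (hc : HasCompactSupport Q) (v : EuclideanSpace ℝ (Fin n)) : ∫ y, fderiv ℝ Q y v = 0 := by
  have hi : Integrable (fun y => fderiv ℝ Q y v) :=
    ((hQ.continuous_fderiv (by simp)).clm_apply continuous_const).integrable_of_hasCompactSupport
      (hc.fderiv_apply (𝕜 := ℝ) v)
  -- Integration by parts against the constant function 1.
  have := integral_mul_fderiv_eq_neg_fderiv_mul_of_integrable (μ := volume)
    (f := fun _ : EuclideanSpace ℝ (Fin n) => (1 : ℝ)) (g := Q) (v := v)
    (by simp) (by simpa using hi)
    (by simpa using hQ.continuous.integrable_of_hasCompactSupport hc)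
    (fun _ _ => differentiableAt_const _) (fun y _ => hQ.differentiable (by simp) y)
  simpa using this

variable [MeasurableSpace M] [BorelSpace M]

lemma setIntegral_source {φ : OpenPartialHomeomorph M (EuclideanSpace ℝ (Fin n))}
    (hφ : φ ∈ atlas (EuclideanSpace ℝ (Fin n)) M) (hF : ContMDiff (𝓡 n) 𝓘(ℝ, Amb n) ∞ F)
    {h : M → ℝ} (hh : Measurable h) :
    ∫ x in φ.source, h x ∂(areaMeasure F) =
      ∫ y in φ.target, chartDensity F φ y * h (φ.symm y) := by
  have h1 : AEMeasurable φ.symm ((volume.restrict φ.target).withDensity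
      fun y => ENNReal.ofReal (chartDensity F φ y)) :=
    (aemeasurable_symm φ).mono_ac (withDensity_absolutelyContinuous _ _)
  rw [restrict_areaMeasure hφ hF, chartArea, integral_map h1 hh.aestronglyMeasurable,
    integral_withDensity_eq_integral_toReal_smul₀ (aemeasurable_chartDensity hφ hF)
      (by simp)]
  refine integral_congr_ae (Filter.Eventually.of_forall fun y => ?_)
  simp [ENNReal.toReal_ofReal (show 0 ≤ chartDensity F φ y from Real.sqrt_nonneg _)]

lemma pd_eq_zero_of_notMem_tsupport {V : Type*} [NormedAddCommGroup V] [NormedSpace ℝ V]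
    {G : M → V} {x : M} (hx : x ∉ tsupport G) : pd (n := n) G x = 0 := by
  funext i
  rw [pd_congr (notMem_tsupport_iff_eventuallyEq.1 hx)]
  exact pd_const 0 x i

lemma surfaceDiv_eq_zero_of_notMem_tsupport {x : M} (hx : x ∉ tsupport W) :
    surfaceDiv F W x = 0 := by
  simp [surfaceDiv, pd_eq_zero_of_notMem_tsupport hx]

lemma hasCompactSupport_surfaceDiv (hW : HasCompactSupport W) :
    HasCompactSupport (surfaceDiv F W) :=
  hW.mono' fun x hx => by
    by_contra h
    exact hx (surfaceDiv_eq_zero_of_notMem_tsupport h)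

/-- The divergence theorem for a field supported in a chart. -/
lemma integral_surfaceDiv_eq_zero_of_chart [T2Space M]
    {φ : OpenPartialHomeomorph M (EuclideanSpace ℝ (Fin n))}
    (hφ : φ ∈ atlas (EuclideanSpace ℝ (Fin n)) M) (hF : ContMDiff (𝓡 n) 𝓘(ℝ, Amb n) ∞ F)
    (himm : ∀ x, (metric F x).det ≠ 0) (hW : ContMDiff (𝓡 n) 𝓘(ℝ, Amb n) ∞ W)
    (htan : ∀ x, W x ∈ Submodule.span ℝ (Set.range (pd (n := n) F x))) (hc : HasCompactSupport W)
    (hsub : tsupport W ⊆ φ.source) : ∫ x, surfaceDiv F W x ∂(areaMeasure F) = 0 := by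
  rw [← setIntegral_eq_integral_of_forall_compl_eq_zero (s := φ.source) fun x hx =>
      surfaceDiv_eq_zero_of_notMem_tsupport fun h => hx (hsub h),
    setIntegral_source hφ hF (contMDiff_surfaceDiv hF himm hW).continuous.measurable]
  set K := φ '' tsupport W
  have hK : IsCompact K := hc.isCompact.image_of_continuousOn (φ.continuousOn.mono hsub)
  have hKsub : K ⊆ φ.target := by rintro _ ⟨x, hx, rfl⟩; exact φ.map_source (hsub hx)
  let q : Fin n → EuclideanSpace ℝ (Fin n) → ℝ := fun k y =>
    chartDensity F φ y * tangentCoeff F W φ y k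
  -- √g wᵏ extended by zero. It is smooth on all of ℝⁿ because it vanishes off the compact set K,
  -- which lies in the open chart image.
  let Q : Fin n → EuclideanSpace ℝ (Fin n) → ℝ := fun k => φ.target.indicator (q k)
  have hQ0 : ∀ k, ∀ y ∉ K, Q k y = 0 := by
    intro k y hy
    by_cases hyt : y ∈ φ.target
    · have : W (φ.symm y) = 0 := by
        by_contra hne
        exact hy ⟨φ.symm y, subset_tsupport _ hne, φ.right_inv hyt⟩
      simp [Q, q, tangentCoeff, this]
    · exact Set.indicator_of_notMem hyt _
  have hQq : ∀ k, ∀ y ∈ φ.target, Q k =ᶠ[𝓝 y] q k := fun k y hy => by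
    filter_upwards [φ.open_target.mem_nhds hy] with z hz using Set.indicator_of_mem hz _
  have hQ : ∀ k, ContDiff ℝ ∞ (Q k) := by
    intro k
    rw [contDiff_iff_contDiffAt]
    intro y
    by_cases hy : y ∈ K
    · refine ContDiffAt.congr_of_eventuallyEq ?_ (hQq k y (hKsub hy))
      exact ((contDiffOn_chartDensity hφ hF himm).mul
        (contDiffOn_tangentCoeff hφ hF himm hW k)).contDiffAt
          (φ.open_target.mem_nhds (hKsub hy))
    · refine contDiffAt_const (c := (0 : ℝ)) |>.congr_of_eventuallyEq ?_
      filter_upwards [hK.isClosed.isOpen_compl.mem_nhds hy] with z hz using hQ0 k z hz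
  have hQc : ∀ k, HasCompactSupport (Q k) := fun k => HasCompactSupport.intro hK (hQ0 k)
  have hsum : ∀ y ∈ φ.target, chartDensity F φ y * surfaceDiv F W (φ.symm y) =
      ∑ k, fderiv ℝ (Q k) y (EuclideanSpace.single k 1) := by
    intro y hy
    rw [← sum_fderiv_density_mul_tangentCoeff hφ hF himm hW htan hy]
    exact Finset.sum_congr rfl fun k _ => by rw [(hQq k y hy).fderiv_eq]
  rw [setIntegral_congr_fun φ.open_target.measurableSet hsum,
    setIntegral_eq_integral_of_forall_compl_eq_zero, integral_finsetSum]
  · exact Finset.sum_eq_zero fun k _ => integral_fderiv_eq_zero (hQ k) (hQc k) _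
  · intro k _
    exact (((hQ k).continuous_fderiv (by simp)).clm_apply
      continuous_const).integrable_of_hasCompactSupport ((hQc k).fderiv_apply (𝕜 := ℝ) _)
  · intro y hy
    refine Finset.sum_eq_zero fun k _ => ?_
    have : Q k =ᶠ[𝓝 y] fun _ => 0 := by
      filter_upwards [hK.isClosed.isOpen_compl.mem_nhds fun h => hy (hKsub h)] with z hz
        using hQ0 k z hz
    rw [this.fderiv_eq]; simp

lemma pd_sum {κ V : Type*} [NormedAddCommGroup V] [NormedSpace ℝ V] (s : Finset κ)
    {G : κ → M → V} {x : M} (hG : ∀ k, ContMDiffAt (𝓡 n) 𝓘(ℝ, V) ∞ (G k) x) (i : Fin n) :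
    pd (fun z => ∑ k ∈ s, G k z) x i = ∑ k ∈ s, pd (G k) x i := by
  classical
  induction s using Finset.induction_on with
  | empty => simpa using pd_const (n := n) (0 : V) x i
  | insert a s ha ih =>
    simp only [Finset.sum_insert ha]
    rw [pd_add (hG a) (contMDiffAt_finsetSum fun k _ => hG k), ih]

/-- A partition of unity subordinate to finitely many charts covering the support of W. The ρ k sum
to 1 only there, which suffices because W is zero elsewhere. -/
lemma exists_smooth_chart_decomposition [T2Space M] [SecondCountableTopology M]
    (hc : HasCompactSupport W) :
    ∃ (t : Finset M) (ρ : t → M → ℝ), (∀ k, ContMDiff (𝓡 n) 𝓘(ℝ, ℝ) ∞ (ρ k)) ∧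
      (∀ k : t, tsupport (ρ k) ⊆ (chartAt (EuclideanSpace ℝ (Fin n)) (k : M)).source) ∧
      W = fun z => ∑ k, ρ k z • W z := by
  have : LocallyCompactSpace M := ChartedSpace.locallyCompactSpace (EuclideanSpace ℝ (Fin n)) M
  obtain ⟨t, ht⟩ := hc.isCompact.elim_nhds_subcover
    (fun x : M => (chartAt (EuclideanSpace ℝ (Fin n)) x).source)
    fun x _ => chart_source_mem_nhds _ x
  obtain ⟨ρ, hρ⟩ := SmoothPartitionOfUnity.exists_isSubordinate (𝓡 n)
    (isClosed_tsupport W) (fun x : t => (chartAt (EuclideanSpace ℝ (Fin n)) (x : M)).source)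
    (fun x => (chartAt (EuclideanSpace ℝ (Fin n)) (x : M)).open_source)
    (by simpa [Set.iUnion_subtype] using ht.2)
  refine ⟨t, fun k z => ρ k z, fun k => (ρ k).contMDiff, fun k => hρ k, ?_⟩
  funext z
  rw [← Finset.sum_smul]
  by_cases hz : z ∈ tsupport W
  · have h := ρ.sum_eq_one hz
    rw [finsum_eq_sum_of_fintype] at h
    rw [h, one_smul]
  · rw [image_eq_zero_of_notMem_tsupport hz, smul_zero]

/-- The divergence theorem on `M` for the metric induced by `F`. -/
theorem integral_surfaceDiv_eq_zero [T2Space M] [SecondCountableTopology M]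
    (hF : ContMDiff (𝓡 n) 𝓘(ℝ, Amb n) ∞ F)
    (himm : ∀ x, (metric F x).det ≠ 0) (hW : ContMDiff (𝓡 n) 𝓘(ℝ, Amb n) ∞ W)
    (htan : ∀ x, W x ∈ Submodule.span ℝ (Set.range (pd (n := n) F x))) (hc : HasCompactSupport W) :
    ∫ x, surfaceDiv F W x ∂(areaMeasure F) = 0 := by
  have := isLocallyFiniteMeasure_areaMeasure hF
  obtain ⟨t, ρ, hρs, hρ, hWsum⟩ := exists_smooth_chart_decomposition hc
  have hρW : ∀ k, ContMDiff (𝓡 n) 𝓘(ℝ, Amb n) ∞ fun z => ρ k z • W z := fun k =>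
    (hρs k).smul hW
  have hρc : ∀ k, HasCompactSupport fun z => ρ k z • W z := fun k =>
    hc.mono' fun z hz => subset_tsupport _ fun h => hz (by simp [h])
  have hdiv : surfaceDiv F W = fun x => ∑ k, surfaceDiv F (fun z => ρ k z • W z) x := by
    funext x
    conv_lhs => rw [hWsum]
    rw [surfaceDiv_eq_frameDiv]
    simp only [surfaceDiv_eq_frameDiv]
    rw [← frameDiv_sum]
    congr 1
    funext i
    exact pd_sum _ (fun k => hρW k x) i
  rw [hdiv, integral_finsetSum]
  · refine Finset.sum_eq_zero fun k _ => integral_surfaceDiv_eq_zero_of_chart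
      (chart_mem_atlas (EuclideanSpace ℝ (Fin n)) (k : M)) hF himm (hρW k)
      (fun x => Submodule.smul_mem _ _ (htan x)) (hρc k) ?_
    exact (tsupport_smul_subset_left _ _).trans (hρ k)
  · intro k _
    exact (contMDiff_surfaceDiv hF himm (hρW k)).continuous.integrable_of_hasCompactSupport
      (hasCompactSupport_surfaceDiv (hρc k))

end Divergence
-- Jointly smooth one-parameter families and differentiation under the integral.
section Families

variable {n : ℕ} {M : Type*} [TopologicalSpace M] [ChartedSpace (EuclideanSpace ℝ (Fin n)) M]
  [IsManifold (𝓡 n) ∞ M]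
variable {V : Type*} [NormedAddCommGroup V] [NormedSpace ℝ V]

variable (n) in
/-- A family of maps on `M` which is jointly smooth for times in `(-a, a)`. -/
def SmoothFam (a : ℝ) (h : ℝ → M → V) : Prop :=
  ∀ φ ∈ atlas (EuclideanSpace ℝ (Fin n)) M, ContDiffOn ℝ ∞
    (fun p : ℝ × EuclideanSpace ℝ (Fin n) => h p.1 (φ.symm p.2)) (Set.Ioo (-a) a ×ˢ φ.target)

/-- The time derivative of a family of maps. -/
def dot {M V : Type*} [NormedAddCommGroup V] [NormedSpace ℝ V] (h : ℝ → M → V) (s : ℝ) (x : M) :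
    V := deriv (fun t => h t x) s

lemma SmoothFam.mono {a b : ℝ} {h : ℝ → M → V} (hh : SmoothFam n a h) (hb : b ≤ a) :
    SmoothFam n b h := fun φ hφ =>
  (hh φ hφ).mono (Set.prod_mono (Set.Ioo_subset_Ioo (neg_le_neg hb) hb) le_rfl)

lemma isOpen_Ioo_prod (a : ℝ) (φ : OpenPartialHomeomorph M (EuclideanSpace ℝ (Fin n))) :
    IsOpen (Set.Ioo (-a) a ×ˢ φ.target) := isOpen_Ioo.prod φ.open_target

lemma smoothFam_of_contMDiffOn {a : ℝ} {h : ℝ → M → V}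
    (hh : ContMDiffOn (𝓘(ℝ, ℝ).prod (𝓡 n)) 𝓘(ℝ, V) ∞ (fun p : ℝ × M => h p.1 p.2)
      (Set.Ioo (-a) a ×ˢ Set.univ)) : SmoothFam n a h := by
  intro φ hφ
  have h1 : ContMDiffOn (𝓘(ℝ, ℝ).prod (𝓡 n)) (𝓘(ℝ, ℝ).prod (𝓡 n)) ∞
      (fun p : ℝ × EuclideanSpace ℝ (Fin n) => (p.1, φ.symm p.2))
      (Set.Ioo (-a) a ×ˢ φ.target) :=
    contMDiffOn_fst.prodMk ((contMDiffOn_symm_of_mem_maximalAtlas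
      (IsManifold.subset_maximalAtlas hφ)).comp contMDiffOn_snd fun p hp => hp.2)
  have h2 := hh.comp h1 fun p hp => ⟨hp.1, Set.mem_univ _⟩
  -- On ℝ × ℝⁿ the product manifold structure is that of the vector space, so manifold smoothness
  -- becomes ordinary smoothness.
  rw [← modelWithCornersSelf_prod, chartedSpaceSelf_prod] at h2
  exact h2.contDiffOn

lemma SmoothFam.contMDiff {a : ℝ} {h : ℝ → M → V} (hh : SmoothFam n a h) {s : ℝ}
    (hs : s ∈ Set.Ioo (-a) a) : ContMDiff (𝓡 n) 𝓘(ℝ, V) ∞ (h s) := by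
  intro x
  have hφ := chart_mem_atlas (EuclideanSpace ℝ (Fin n)) x
  refine contMDiffAt_of_comp_symm hφ (mem_chart_source _ x) ?_
  have h1 := (hh _ hφ).contDiffAt ((isOpen_Ioo_prod a _).mem_nhds
    (show (s, chartAt (EuclideanSpace ℝ (Fin n)) x x) ∈ _ from ⟨hs, mem_chart_target _ x⟩))
  exact h1.comp (chartAt (EuclideanSpace ℝ (Fin n)) x x)
    ((contDiff_prodMk_right s).contDiffAt)

lemma SmoothFam.continuousOn {a : ℝ} {h : ℝ → M → V} (hh : SmoothFam n a h) :
    ContinuousOn (fun p : ℝ × M => h p.1 p.2) (Set.Ioo (-a) a ×ˢ Set.univ) := by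
  rintro ⟨s, x⟩ ⟨hs, -⟩
  set φ := chartAt (EuclideanSpace ℝ (Fin n)) x
  have hφ : φ ∈ atlas (EuclideanSpace ℝ (Fin n)) M := chart_mem_atlas _ x
  have hx : x ∈ φ.source := mem_chart_source _ x
  have h1 : ContinuousAt (fun p : ℝ × EuclideanSpace ℝ (Fin n) => h p.1 (φ.symm p.2)) (s, φ x) :=
    (hh φ hφ).continuousOn.continuousAt ((isOpen_Ioo_prod a φ).mem_nhds
      ⟨hs, φ.map_source hx⟩)
  have h2 : ContinuousAt (fun p : ℝ × M => (p.1, φ p.2)) (s, x) :=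
    continuousAt_fst.prodMk (ContinuousAt.comp (f := Prod.snd) (φ.continuousAt hx) continuousAt_snd)
  have h3 := ContinuousAt.comp (f := fun p : ℝ × M => (p.1, φ p.2)) h1 h2
  refine (h3.congr ?_).continuousWithinAt
  have : ∀ᶠ p : ℝ × M in 𝓝 (s, x), p.2 ∈ φ.source :=
    continuousAt_snd (φ.open_source.mem_nhds hx)
  filter_upwards [this] with p hp
  simp [φ.left_inv hp]

lemma SmoothFam.hasFDerivAt {a : ℝ} {h : ℝ → M → V} (hh : SmoothFam n a h)
    {φ : OpenPartialHomeomorph M (EuclideanSpace ℝ (Fin n))}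
    (hφ : φ ∈ atlas (EuclideanSpace ℝ (Fin n)) M) {s : ℝ} (hs : s ∈ Set.Ioo (-a) a)
    {y : EuclideanSpace ℝ (Fin n)} (hy : y ∈ φ.target) :
    HasFDerivAt (fun p : ℝ × EuclideanSpace ℝ (Fin n) => h p.1 (φ.symm p.2))
      (fderiv ℝ (fun p : ℝ × EuclideanSpace ℝ (Fin n) => h p.1 (φ.symm p.2)) (s, y)) (s, y) :=
  (((hh φ hφ).contDiffAt ((isOpen_Ioo_prod a φ).mem_nhds ⟨hs, hy⟩)).differentiableAt
    (by simp)).hasFDerivAt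

lemma SmoothFam.hasDerivAt_chart {a : ℝ} {h : ℝ → M → V} (hh : SmoothFam n a h)
    {φ : OpenPartialHomeomorph M (EuclideanSpace ℝ (Fin n))}
    (hφ : φ ∈ atlas (EuclideanSpace ℝ (Fin n)) M) {s : ℝ} (hs : s ∈ Set.Ioo (-a) a)
    {y : EuclideanSpace ℝ (Fin n)} (hy : y ∈ φ.target) :
    HasDerivAt (fun t => h t (φ.symm y))
      (fderiv ℝ (fun p : ℝ × EuclideanSpace ℝ (Fin n) => h p.1 (φ.symm p.2)) (s, y) (1, 0)) s :=
  HasFDerivAt.comp_hasDerivAt (f := fun t => (t, y)) s (hh.hasFDerivAt hφ hs hy)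
    ((hasDerivAt_id s).prodMk (hasDerivAt_const s y))

lemma SmoothFam.hasDerivAt {a : ℝ} {h : ℝ → M → V} (hh : SmoothFam n a h) {s : ℝ}
    (hs : s ∈ Set.Ioo (-a) a) (x : M) : HasDerivAt (fun t => h t x) (dot h s x) s := by
  have h1 := hh.hasDerivAt_chart (chart_mem_atlas (EuclideanSpace ℝ (Fin n)) x) hs
    (mem_chart_target _ x)
  rw [OpenPartialHomeomorph.left_inv _ (mem_chart_source _ x)] at h1
  exact h1.differentiableAt.hasDerivAt

lemma SmoothFam.dot_chart {a : ℝ} {h : ℝ → M → V} (hh : SmoothFam n a h)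
    {φ : OpenPartialHomeomorph M (EuclideanSpace ℝ (Fin n))}
    (hφ : φ ∈ atlas (EuclideanSpace ℝ (Fin n)) M) {s : ℝ} (hs : s ∈ Set.Ioo (-a) a)
    {y : EuclideanSpace ℝ (Fin n)} (hy : y ∈ φ.target) : dot h s (φ.symm y) =
      fderiv ℝ (fun p : ℝ × EuclideanSpace ℝ (Fin n) => h p.1 (φ.symm p.2)) (s, y) (1, 0) :=
  (hh.hasDerivAt_chart hφ hs hy).deriv

/-- In a chart the time derivative is the directional derivative along (1, 0), hence again jointly
smooth; this allows `dot` to be iterated. -/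
lemma SmoothFam.dot {a : ℝ} {h : ℝ → M → V} (hh : SmoothFam n a h) : SmoothFam n a (dot h) := by
  intro φ hφ
  refine (((hh φ hφ).fderiv_of_isOpen (isOpen_Ioo_prod a φ) (m := ∞) (by simp)).clm_apply
    (contDiffOn_const (c := ((1, 0) : ℝ × EuclideanSpace ℝ (Fin n))))).congr fun p hp => ?_
  exact hh.dot_chart hφ hp.1 hp.2

lemma SmoothFam.cpd_eq {a : ℝ} {h : ℝ → M → V} (hh : SmoothFam n a h)
    {φ : OpenPartialHomeomorph M (EuclideanSpace ℝ (Fin n))}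
    (hφ : φ ∈ atlas (EuclideanSpace ℝ (Fin n)) M) {s : ℝ} (hs : s ∈ Set.Ioo (-a) a)
    {y : EuclideanSpace ℝ (Fin n)} (hy : y ∈ φ.target) (i : Fin n) : cpd φ (h s) y i =
      fderiv ℝ (fun p : ℝ × EuclideanSpace ℝ (Fin n) => h p.1 (φ.symm p.2)) (s, y)
        (0, EuclideanSpace.single i 1) := by
  have h1 := HasFDerivAt.comp (f := fun z => (s, z)) y (hh.hasFDerivAt hφ hs hy)
    (hasFDerivAt_prodMk_right s y)
  rw [cpd_of_hasFDerivAt (φ := φ) (G := h s) h1]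
  simp

lemma SmoothFam.contDiffOn_cpd {a : ℝ} {h : ℝ → M → V} (hh : SmoothFam n a h)
    {φ : OpenPartialHomeomorph M (EuclideanSpace ℝ (Fin n))}
    (hφ : φ ∈ atlas (EuclideanSpace ℝ (Fin n)) M) (i : Fin n) :
    ContDiffOn ℝ ∞ (fun p : ℝ × EuclideanSpace ℝ (Fin n) => cpd φ (h p.1) p.2 i)
      (Set.Ioo (-a) a ×ˢ φ.target) := by
  refine (((hh φ hφ).fderiv_of_isOpen (isOpen_Ioo_prod a φ) (m := ∞) (by simp)).clm_apply
    (contDiffOn_const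
      (c := ((0, EuclideanSpace.single i 1) : ℝ × EuclideanSpace ℝ (Fin n))))).congr fun p hp => ?_
  exact hh.cpd_eq hφ hp.1 hp.2 i

/-- Time and space derivatives commute. -/
lemma SmoothFam.hasDerivAt_pd {a : ℝ} {h : ℝ → M → V} (hh : SmoothFam n a h) {s : ℝ}
    (hs : s ∈ Set.Ioo (-a) a) (x : M) (i : Fin n) :
    HasDerivAt (fun t => pd (h t) x i) (pd (WeightedArea.dot h s) x i) s := by
  set φ := chartAt (EuclideanSpace ℝ (Fin n)) x
  have hφ : φ ∈ atlas (EuclideanSpace ℝ (Fin n)) M := chart_mem_atlas _ x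
  have hy : φ x ∈ φ.target := mem_chart_target _ x
  set H := fun p : ℝ × EuclideanSpace ℝ (Fin n) => h p.1 (φ.symm p.2)
  have hH : ContDiffAt ℝ ∞ H (s, φ x) :=
    (hh φ hφ).contDiffAt ((isOpen_Ioo_prod a φ).mem_nhds ⟨hs, hy⟩)
  -- Symmetry of the second derivative of H on ℝ × ℝⁿ, to be applied to the directions (1, 0) and
  -- (0, e_i).
  have hsymm := hH.isSymmSndFDerivAt (by
    rw [minSmoothness_of_isRCLikeNormedField]; exact WithTop.coe_le_coe.2 (le_top : (2 : ℕ∞) ≤ ⊤))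
  have h3 : HasFDerivAt (fderiv ℝ H) (fderiv ℝ (fderiv ℝ H) (s, φ x)) (s, φ x) :=
    ((hH.fderiv_right (m := ∞) (by simp)).differentiableAt (by simp)).hasFDerivAt
  have h4 : HasDerivAt (fun t => fderiv ℝ H (t, φ x) (0, EuclideanSpace.single i 1))
      (fderiv ℝ (fderiv ℝ H) (s, φ x) (1, 0) (0, EuclideanSpace.single i 1)) s := by
    have h5 := HasFDerivAt.comp_hasDerivAt (f := fun t => (t, φ x)) s h3
      ((hasDerivAt_id s).prodMk (hasDerivAt_const s (φ x)))
    simpa using h5.clm_apply (hasDerivAt_const s ((0, EuclideanSpace.single i 1) :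
      ℝ × EuclideanSpace ℝ (Fin n)))
  have h6 : pd (WeightedArea.dot h s) x i =
      fderiv ℝ (fderiv ℝ H) (s, φ x) (1, 0) (0, EuclideanSpace.single i 1) := by
    have h7 : HasFDerivAt (fun z => fderiv ℝ H (s, z) (1, 0))
        (((fderiv ℝ (fderiv ℝ H) (s, φ x)).comp
          (ContinuousLinearMap.inr ℝ ℝ (EuclideanSpace ℝ (Fin n)))).flip (1, 0)) (φ x) := by
      have h8 := HasFDerivAt.comp (f := fun z => (s, z)) (φ x) h3 (hasFDerivAt_prodMk_right s _)
      have h9 := h8.clm_apply (hasFDerivAt_const ((1, 0) : ℝ × EuclideanSpace ℝ (Fin n)) (φ x))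
      simpa using h9
    have h10 : (WeightedArea.dot h s ∘ φ.symm) =ᶠ[𝓝 (φ x)]
        fun z => fderiv ℝ H (s, z) (1, 0) := by
      filter_upwards [φ.open_target.mem_nhds hy] with z hz using hh.dot_chart hφ hs hz
    rw [pd_of_hasFDerivAt (hh.dot.contMDiff hs x) (h7.congr_of_eventuallyEq h10)]
    rw [hsymm]
    simp
  rw [h6]
  refine h4.congr_of_eventuallyEq ?_
  filter_upwards [isOpen_Ioo.mem_nhds hs] with t ht
  rw [pd_eq_cpd (hh.contMDiff ht x)]
  exact hh.cpd_eq hφ ht hy i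

lemma dot_eq_zero_of_const {a : ℝ} {h : ℝ → M → V} {x : M}
    (hx : ∀ s ∈ Set.Ioo (-a) a, h s x = h 0 x) {s : ℝ} (hs : s ∈ Set.Ioo (-a) a) :
    dot h s x = 0 := by
  have : (fun t => h t x) =ᶠ[𝓝 s] fun _ => h 0 x := by
    filter_upwards [isOpen_Ioo.mem_nhds hs] with t ht using hx t ht
  rw [dot, this.deriv_eq, deriv_const]

open MeasureTheory in
/-- Differentiation under the integral sign. -/
lemma SmoothFam.hasDerivAt_setIntegral [T2Space M] [MeasurableSpace M] [BorelSpace M]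
    {μ : Measure M} [IsFiniteMeasureOnCompacts μ] {a : ℝ} {h : ℝ → M → ℝ}
    (hh : SmoothFam n a h) {Ω K : Set M} (hΩ' : IsCompact (closure Ω))
    (hK : IsCompact K) (hconst : ∀ s ∈ Set.Ioo (-a) a, ∀ x ∉ K, h s x = h 0 x) {s : ℝ}
    (hs : s ∈ Set.Ioo (-a) a) :
    HasDerivAt (fun t => ∫ x in Ω, h t x ∂μ) (∫ x in Ω, WeightedArea.dot h s x ∂μ) s := by
  obtain ⟨δ, hδ, hball⟩ := Metric.nhds_basis_closedBall.mem_iff.1 (isOpen_Ioo.mem_nhds hs)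
  have hcont : ∀ t ∈ Set.Ioo (-a) a, Continuous (h t) := fun t ht => (hh.contMDiff ht).continuous
  -- The dominating constant: the time derivative is bounded on the compact set of times near s and
  -- points of K, and is zero off K. The bound below is `max C 0` because C may be negative if K is
  -- empty.
  obtain ⟨C, hC⟩ := ((isCompact_closedBall s δ).prod hK).bddAbove_image
    (f := fun p : ℝ × M => ‖WeightedArea.dot h p.1 p.2‖)
    ((hh.dot.continuousOn.norm).mono (Set.prod_mono hball (Set.subset_univ _)))
  have hfin : μ Ω < ⊤ := (measure_mono subset_closure).trans_lt hΩ'.measure_lt_top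
  refine (hasDerivAt_integral_of_dominated_loc_of_deriv_le (μ := μ.restrict Ω)
    (bound := fun _ => max C 0) (s := Metric.closedBall s δ)
    (Metric.closedBall_mem_nhds s hδ) ?_ ?_ ?_ ?_ ?_ ?_).2
  · filter_upwards [isOpen_Ioo.mem_nhds hs] with t ht using
      (hcont t ht).aestronglyMeasurable
  · exact ((hcont s hs).continuousOn.integrableOn_compact hΩ').mono_set subset_closure
  · exact (hh.dot.contMDiff hs).continuous.aestronglyMeasurable
  · refine Filter.Eventually.of_forall fun x t ht => ?_
    by_cases hx : x ∈ K
    · exact (hC ⟨(t, x), ⟨ht, hx⟩, rfl⟩).trans (le_max_left _ _)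
    · rw [dot_eq_zero_of_const (fun r hr => hconst r hr x hx) (hball ht), norm_zero]
      exact le_max_right _ _
  · have : IsFiniteMeasure (μ.restrict Ω) := ⟨by simpa using hfin⟩
    exact integrable_const _
  · exact Filter.Eventually.of_forall fun x t ht => hh.hasDerivAt (hball ht) x

end Families
-- First and second time derivatives of the weighted area density.
section WeightedDensity

open MeasureTheory

variable {n : ℕ} {M : Type*} [TopologicalSpace M] [ChartedSpace (EuclideanSpace ℝ (Fin n)) M]
  [IsManifold (𝓡 n) ∞ M] {F : M → Amb n} {Ψ : ℝ → M → Amb n} {a : ℝ}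

/-- The density of the weighted area of `G` with respect to the area measure of `F`. -/
def weightedDensity (F G : M → Amb n) (x : M) : ℝ :=
  Real.exp (-height G x) * √(sqJacobian F G x)

lemma smoothFam_sqJacobian (hF : ContMDiff (𝓡 n) 𝓘(ℝ, Amb n) ∞ F)
    (himm : ∀ x, (metric F x).det ≠ 0) (hΨ : SmoothFam n a Ψ) :
    SmoothFam n a fun s => sqJacobian F (Ψ s) := by
  intro φ hφ
  have hFc : ∀ i, ContDiffOn ℝ ∞ (fun p : ℝ × EuclideanSpace ℝ (Fin n) => cpd φ F p.2 i)
      (Set.Ioo (-a) a ×ˢ φ.target) := fun i =>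
    (contDiffOn_cpd hφ hF i).comp contDiffOn_snd fun p hp => hp.2
  refine ((contDiffOn_det (contDiffOn_crossGram (hΨ.contDiffOn_cpd hφ)
    (hΨ.contDiffOn_cpd hφ))).div (contDiffOn_det (contDiffOn_crossGram hFc hFc))
    fun p hp => det_gram_cpd_ne_zero hφ hF himm hp.2).congr fun p hp => ?_
  beta_reduce
  rw [sqJacobian_eq_cpd hφ (φ.map_target hp.2) (hF _) (hΨ.contMDiff hp.1 _), φ.right_inv hp.2]
  rfl

lemma sqJacobian_ne_zero {G : M → Amb n} {x : M} (hF : (metric F x).det ≠ 0)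
    (hG : (metric G x).det ≠ 0) : sqJacobian F G x ≠ 0 := div_ne_zero hG hF

lemma smoothFam_weightedDensity (hF : ContMDiff (𝓡 n) 𝓘(ℝ, Amb n) ∞ F)
    (himm : ∀ x, (metric F x).det ≠ 0) (hΨ : SmoothFam n a Ψ)
    (hΨimm : ∀ s ∈ Set.Ioo (-a) a, ∀ x, (metric (Ψ s) x).det ≠ 0) :
    SmoothFam n a fun s => weightedDensity F (Ψ s) := by
  intro φ hφ
  have h1 : ContDiffOn ℝ ∞ (fun p : ℝ × EuclideanSpace ℝ (Fin n) =>
      height (Ψ p.1) (φ.symm p.2)) (Set.Ioo (-a) a ×ˢ φ.target) := by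
    simp only [height_eq_inner]
    exact contDiffOn_const.inner ℝ (hΨ φ hφ)
  exact h1.neg.exp.mul ((smoothFam_sqJacobian hF himm hΨ φ hφ).sqrt fun p hp =>
    sqJacobian_ne_zero (himm _) (hΨimm _ hp.1 _))

lemma metric_congr {G G' : M → Amb n} {x : M} (h : G =ᶠ[𝓝 x] G') : metric G x = metric G' x := by
  rw [metric_eq_gram, metric_eq_gram, pd_congr h]

/-- A compactly supported variation of an immersion consists of immersions for small times. -/
lemma exists_forall_det_metric_ne_zero [T2Space M] (ha : 0 < a)
    (hF : ContMDiff (𝓡 n) 𝓘(ℝ, Amb n) ∞ F) (himm : ∀ x, (metric F x).det ≠ 0)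
    (hΨ : SmoothFam n a Ψ) (hΨ0 : Ψ 0 = F) {K : Set M} (hK : IsCompact K)
    (hconst : ∀ s ∈ Set.Ioo (-a) a, ∀ x ∉ K, Ψ s x = F x) :
    ∃ b > 0, b ≤ a ∧ ∀ s ∈ Set.Ioo (-b) b, ∀ x, (metric (Ψ s) x).det ≠ 0 := by
  have h0 : (0 : ℝ) ∈ Set.Ioo (-a) a := ⟨by linarith, ha⟩
  have hc := (smoothFam_sqJacobian hF himm hΨ).continuousOn
  -- The Jacobian is nonzero at time 0 and jointly continuous, so compactness of K gives one time
  -- interval valid for all of K. Off K the maps agree with F near the point.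
  have h1 : ∀ᶠ s in 𝓝 (0 : ℝ), ∀ x ∈ K, sqJacobian F (Ψ s) x ≠ 0 := by
    refine hK.eventually_forall_of_forall_eventually fun x _ => ?_
    have h2 : ContinuousAt (fun p : ℝ × M => sqJacobian F (Ψ p.1) p.2) (0, x) :=
      hc.continuousAt ((isOpen_Ioo.prod isOpen_univ).mem_nhds ⟨h0, Set.mem_univ _⟩)
    refine h2.eventually_ne ?_
    rw [hΨ0]
    exact sqJacobian_ne_zero (himm x) (himm x)
  obtain ⟨δ, hδ, hball⟩ := Metric.eventually_nhds_iff.1 h1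
  refine ⟨min δ a, lt_min hδ ha, min_le_right _ _, fun s hs x => ?_⟩
  have hsa : s ∈ Set.Ioo (-a) a :=
    ⟨by have := min_le_right δ a; linarith [hs.1], hs.2.trans_le (min_le_right _ _)⟩
  by_cases hx : x ∈ K
  · have hsδ : dist s 0 < δ := by
      rw [Real.dist_eq, sub_zero, abs_lt]
      exact ⟨by have := min_le_left δ a; linarith [hs.1], hs.2.trans_le (min_le_left _ _)⟩
    intro h
    exact hball hsδ x hx (by rw [sqJacobian, h, zero_div])
  · rw [metric_congr (G' := F)]
    · exact himm x
    · filter_upwards [hK.isClosed.isOpen_compl.mem_nhds hx] with z hz using hconst s hsa z hz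

lemma weightedDensity_eq_of_notMem [T2Space M] {K : Set M} (hK : IsCompact K)
    (hΨ0 : Ψ 0 = F) (hconst : ∀ s ∈ Set.Ioo (-a) a, ∀ x ∉ K, Ψ s x = F x) {s : ℝ}
    (hs : s ∈ Set.Ioo (-a) a) {x : M} (hx : x ∉ K) :
    weightedDensity F (Ψ s) x = weightedDensity F (Ψ 0) x := by
  have h : Ψ s =ᶠ[𝓝 x] F := by
    filter_upwards [hK.isClosed.isOpen_compl.mem_nhds hx] with z hz using hconst s hs z hz
  rw [hΨ0, weightedDensity, weightedDensity, sqJacobian, metric_congr h, sqJacobian, height,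
    height, h.eq_of_nhds]

/-- Moves the dependence on G from the measure into the integrand, so that a variation can be
differentiated under a fixed integral. -/
lemma weightedArea_eq_setIntegral [SecondCountableTopology M] [MeasurableSpace M] [BorelSpace M]
    {G : M → Amb n} (hF : ContMDiff (𝓡 n) 𝓘(ℝ, Amb n) ∞ F) (himm : ∀ x, (metric F x).det ≠ 0)
    (hG : ContMDiff (𝓡 n) 𝓘(ℝ, Amb n) ∞ G) {Ω : Set M} (hΩ : IsOpen Ω) :
    weightedArea G Ω = ∫ x in Ω, weightedDensity F G x ∂(areaMeasure F) := by
  have hmeas : Measurable fun x => ENNReal.ofReal √(sqJacobian F G x) :=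
    ((contMDiff_sqJacobian hF himm hG).continuous.sqrt.measurable).ennreal_ofReal
  rw [weightedArea, areaMeasure_eq_withDensity hF himm hG,
    restrict_withDensity hΩ.measurableSet,
    integral_withDensity_eq_integral_toReal_smul hmeas (by simp)]
  refine integral_congr_ae (Filter.Eventually.of_forall fun x => ?_)
  simp [weightedDensity, mul_comm]

lemma hasDerivAt_height (hΨ : SmoothFam n a Ψ) {s : ℝ} (hs : s ∈ Set.Ioo (-a) a) (x : M) :
    HasDerivAt (fun t => height (Ψ t) x) (inner ℝ (eLast n) (dot Ψ s x)) s := by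
  simp only [height_eq_inner]
  simpa using (hasDerivAt_const s (eLast n)).inner ℝ (hΨ.hasDerivAt hs x)

/-- The first variation of the weighted area density. -/
lemma hasDerivAt_weightedDensity (hΨ : SmoothFam n a Ψ)
    (hΨimm : ∀ s ∈ Set.Ioo (-a) a, ∀ x, (metric (Ψ s) x).det ≠ 0) {s : ℝ}
    (hs : s ∈ Set.Ioo (-a) a) (x : M) :
    HasDerivAt (fun t => weightedDensity F (Ψ t) x) (weightedDensity F (Ψ s) x *
      (surfaceDiv (Ψ s) (dot Ψ s) x - inner ℝ (eLast n) (dot Ψ s x))) s := by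
  have h1 : ∀ t, √(sqJacobian F (Ψ t) x) =
      √(Matrix.gram ℝ (pd (n := n) (Ψ t) x)).det / √(metric F x).det := fun t => by
    rw [sqJacobian, metric_eq_gram (Ψ t), Real.sqrt_div (Matrix.posSemidef_gram ℝ _).det_nonneg]
  have h2 := ((hasDerivAt_height hΨ hs x).neg.exp).mul
    ((hasDerivAt_sqrt_det_gram (hΨ.hasDerivAt_pd hs x) (hΨimm s hs x)).div_const
      √(metric F x).det)
  simp only [weightedDensity, h1]
  refine h2.congr_deriv ?_
  rw [surfaceDiv_eq_frameDiv]
  simp only [Pi.neg_apply]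
  ring

lemma dot_weightedDensity (hΨ : SmoothFam n a Ψ)
    (hΨimm : ∀ s ∈ Set.Ioo (-a) a, ∀ x, (metric (Ψ s) x).det ≠ 0) {s : ℝ}
    (hs : s ∈ Set.Ioo (-a) a) (x : M) :
    dot (fun t => weightedDensity F (Ψ t)) s x = weightedDensity F (Ψ s) x *
      (surfaceDiv (Ψ s) (dot Ψ s) x - inner ℝ (eLast n) (dot Ψ s x)) :=
  (hasDerivAt_weightedDensity hΨ hΨimm hs x).deriv

lemma weightedDensity_self {x : M} (h : (metric F x).det ≠ 0) :
    weightedDensity F F x = Real.exp (-height F x) := by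
  rw [weightedDensity, sqJacobian, div_self h, Real.sqrt_one, mul_one]

/-- The second variation of the area density of a frame, apart from the acceleration term. -/
def frameHess (P Q : Fin n → Amb n) : ℝ :=
  frameNormSq P Q - ∑ i, ∑ j, ((Matrix.gram ℝ P)⁻¹ *
    (crossGram P Q + (crossGram P Q).transpose) * (Matrix.gram ℝ P)⁻¹) i j * crossGram P Q i j

/-- The second variation of the weighted area density. -/
lemma dot_dot_weightedDensity (ha : 0 < a) (himm : ∀ x, (metric F x).det ≠ 0)
    (hΨ : SmoothFam n a Ψ) (hΨ0 : Ψ 0 = F)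
    (hΨimm : ∀ s ∈ Set.Ioo (-a) a, ∀ x, (metric (Ψ s) x).det ≠ 0) (x : M) :
    dot (dot fun t => weightedDensity F (Ψ t)) 0 x = Real.exp (-height F x) *
      ((surfaceDiv F (dot Ψ 0) x - inner ℝ (eLast n) (dot Ψ 0 x)) ^ 2 +
        frameHess (pd F x) (pd (dot Ψ 0) x) +
        (surfaceDiv F (dot (dot Ψ) 0) x - inner ℝ (eLast n) (dot (dot Ψ) 0 x))) := by
  have h0 : (0 : ℝ) ∈ Set.Ioo (-a) a := ⟨by linarith, ha⟩
  have h1 := hasDerivAt_weightedDensity (F := F) hΨ hΨimm h0 x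
  have h2 : HasDerivAt (fun t => surfaceDiv (Ψ t) (dot Ψ t) x) _ 0 :=
    hasDerivAt_frameDiv (hΨ.hasDerivAt_pd h0 x) (hΨ.dot.hasDerivAt_pd h0 x) (hΨimm 0 h0 x)
  have h3 : HasDerivAt (fun t => (inner ℝ (eLast n) (dot Ψ t x) : ℝ))
      (inner ℝ (eLast n) (dot (dot Ψ) 0 x)) 0 := by
    simpa using (hasDerivAt_const 0 (eLast n)).inner ℝ (hΨ.dot.hasDerivAt h0 x)
  -- Since w' = wρ with ρ = div X - ⟨e,X⟩, one has w'' = w(ρ² + ρ').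
  have h4 := h1.mul (h2.sub h3)
  have h5 : (fun t => dot (fun t => weightedDensity F (Ψ t)) t x) =ᶠ[𝓝 0]
      fun t => weightedDensity F (Ψ t) x *
        (surfaceDiv (Ψ t) (dot Ψ t) x - inner ℝ (eLast n) (dot Ψ t x)) := by
    filter_upwards [isOpen_Ioo.mem_nhds h0] with t ht using dot_weightedDensity hΨ hΨimm ht x
  rw [dot, h5.deriv_eq]
  refine (h4.congr_deriv ?_).deriv
  simp only [hΨ0, weightedDensity_self (himm x), Pi.sub_apply, frameHess]
  rw [surfaceDiv_eq_frameDiv F (dot (dot Ψ) 0)]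
  ring

end WeightedDensity
-- Frame identities for the second variation.
section FrameAlgebra

variable {ι V : Type*} [Fintype ι] [DecidableEq ι] [NormedAddCommGroup V] [InnerProductSpace ℝ V]

lemma inner_eq_zero_of_mem_span {P : ι → V} {v w : V}
    (hv : v ∈ Submodule.span ℝ (Set.range P)) (hw : ∀ i, inner ℝ w (P i) = 0) :
    inner ℝ w v = 0 := by
  induction hv using Submodule.span_induction with
  | mem z hz => obtain ⟨k, rfl⟩ := hz; exact hw k
  | zero => simp
  | add a b _ _ ha hb => rw [inner_add_right, ha, hb, add_zero]
  | smul c a _ ha => rw [real_inner_smul_right, ha, mul_zero]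

/-- The gradient of a linear function is its tangential projection. -/
lemma inner_frameGrad_inner {P : ι → V} (hP : (Matrix.gram ℝ P).det ≠ 0) {v : V}
    (hv : v ∈ Submodule.span ℝ (Set.range P)) (w : V) :
    inner ℝ v (frameGrad P fun i => inner ℝ w (P i)) = inner ℝ w v := by
  have h := inner_eq_zero_of_mem_span hv
    (w := (frameGrad P fun i => inner ℝ w (P i)) - w) fun i => by
      rw [inner_sub_left, inner_frameGrad hP, sub_self]
  rw [inner_sub_left, sub_eq_zero] at h
  rw [real_inner_comm, h]

lemma frameGrad_smul (P : ι → V) (c : ℝ) (b : ι → ℝ) :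
    frameGrad P (fun i => c * b i) = c • frameGrad P b := by
  simp only [frameGrad, Finset.smul_sum, smul_smul]
  exact Finset.sum_congr rfl fun i _ => Finset.sum_congr rfl fun j _ => by congr 1; ring

lemma frameDiv_mul_add (P Q : ι → V) (c : ℝ) (b : ι → ℝ) (v : V) :
    frameDiv P (fun i => c • Q i + b i • v) = c * frameDiv P Q + inner ℝ v (frameGrad P b) := by
  rw [frameDiv_add, frameDiv_smul, frameDiv_tangent_mul]

/-- Tangential vectors are determined by their products with the frame. For Q_i = ∂_iN the
right-hand side is |A|². -/
lemma frameNormSq_eq {P Q : ι → V} (hP : (Matrix.gram ℝ P).det ≠ 0)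
    (hQ : ∀ i, Q i ∈ Submodule.span ℝ (Set.range P)) :
    frameNormSq P Q = ∑ i, ∑ j, ∑ k, ∑ l, (Matrix.gram ℝ P)⁻¹ i k * (Matrix.gram ℝ P)⁻¹ j l *
      crossGram P Q i j * crossGram P Q k l := by
  have h : ∀ i j, inner ℝ (Q i) (Q j) = ∑ k, ∑ l, (Matrix.gram ℝ P)⁻¹ k l *
      crossGram P Q i k * crossGram P Q j l := by
    intro i j
    conv_lhs => rw [eq_frameGrad hP (hQ i), real_inner_comm, inner_eq_sum_frameGrad]
    rfl
  simp only [frameNormSq, h, Finset.mul_sum]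
  refine Finset.sum_congr rfl fun i _ => ?_
  rw [Finset.sum_comm]
  exact Finset.sum_congr rfl fun k _ => Finset.sum_congr rfl fun j _ =>
    Finset.sum_congr rfl fun l _ => by ring

/-- The second variation of the area density in a normal direction. -/
lemma frameHess_normal {n : ℕ} {P Q : Fin n → Amb n} (hP : (Matrix.gram ℝ P).det ≠ 0)
    {ν : Amb n} (hν : ‖ν‖ = 1) (hνP : ∀ i, inner ℝ ν (P i) = 0)
    (hνQ : ∀ i, inner ℝ ν (Q i) = 0)
    (hsymm : ∀ i j, crossGram P Q i j = crossGram P Q j i) (c : ℝ) (b : Fin n → ℝ) :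
    frameHess P (fun i => c • Q i + b i • ν) =
      (∑ i, ∑ j, (Matrix.gram ℝ P)⁻¹ i j * b i * b j) -
        c ^ 2 * ∑ i, ∑ j, ∑ k, ∑ l, (Matrix.gram ℝ P)⁻¹ i k * (Matrix.gram ℝ P)⁻¹ j l *
          crossGram P Q i j * crossGram P Q k l := by
  have hcross : crossGram P (fun i => c • Q i + b i • ν) = c • crossGram P Q := by
    ext i j
    simp [crossGram, inner_add_left, real_inner_smul_left, hνP]
  have htr : (crossGram P Q).transpose = crossGram P Q := by
    ext i j; exact hsymm j i
  -- With Q_i = ∂_iN, c = u and b_i = ∂_iu this is u²|A|² + |∇u|²; the term `hquad` below is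
  -- 2u²|A|², so the difference is |∇u|² - u²|A|².
  have hnorm : frameNormSq P (fun i => c • Q i + b i • ν) =
      c ^ 2 * frameNormSq P Q + ∑ i, ∑ j, (Matrix.gram ℝ P)⁻¹ i j * b i * b j := by
    simp only [frameNormSq, Finset.mul_sum, ← Finset.sum_add_distrib]
    refine Finset.sum_congr rfl fun i _ => Finset.sum_congr rfl fun j _ => ?_
    have h1 : inner ℝ (Q i) ν = 0 := by rw [real_inner_comm, hνQ]
    have h2 : inner ℝ ν ν = (1 : ℝ) := by rw [real_inner_self_eq_norm_sq, hν, one_pow]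
    simp only [inner_add_left, inner_add_right, real_inner_smul_left, real_inner_smul_right, hνQ,
      h1, h2]
    ring
  have hquad : ∑ i, ∑ j, ((Matrix.gram ℝ P)⁻¹ * (c • crossGram P Q + c • crossGram P Q) *
      (Matrix.gram ℝ P)⁻¹) i j * (c • crossGram P Q) i j = 2 * c ^ 2 * frameNormSq P Q := by
    rw [frameNormSq_eq hP fun i => mem_span_of_inner_normal_eq_zero hP hν hνP (hνQ i)]
    simp only [Finset.mul_sum, Matrix.mul_apply, Finset.sum_mul, Matrix.add_apply,
      Matrix.smul_apply, smul_eq_mul]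
    refine Finset.sum_congr rfl fun i _ => Finset.sum_congr rfl fun j _ => ?_
    rw [Finset.sum_comm]
    refine Finset.sum_congr rfl fun k _ => Finset.sum_congr rfl fun l _ => ?_
    rw [gram_inv_symm P l j]
    ring
  rw [frameHess, hcross, Matrix.transpose_smul, htr, hquad, hnorm, ← frameNormSq_eq hP fun i =>
    mem_span_of_inner_normal_eq_zero hP hν hνP (hνQ i)]
  ring

end FrameAlgebra

/-! ### The unit normal, the second fundamental form and weighted divergences. -/

section Normal

variable {n : ℕ} {M : Type*} [TopologicalSpace M] [ChartedSpace (EuclideanSpace ℝ (Fin n)) M]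
  [IsManifold (𝓡 n) ∞ M] {F N T : M → Amb n} {Ω : Set M} {u : M → ℝ}

lemma IsUnitNormalOn.contMDiffAt (hN : IsUnitNormalOn F N Ω) (hΩ : IsOpen Ω) {x : M}
    (hx : x ∈ Ω) : ContMDiffAt (𝓡 n) 𝓘(ℝ, Amb n) ∞ N x :=
  hN.smooth.contMDiffAt (hΩ.mem_nhds hx)

/-- Differentiate ⟨N,N⟩ = 1. Consequently ∂_iN is tangential, as the second variation requires. -/
lemma IsUnitNormalOn.inner_pd_eq_zero (hN : IsUnitNormalOn F N Ω) (hΩ : IsOpen Ω) {x : M}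
    (hx : x ∈ Ω) (i : Fin n) : inner ℝ (N x) (pd N x i) = 0 := by
  have hs := hN.contMDiffAt hΩ hx
  have h1 := pd_inner hs hs i
  have h2 : (fun z => (inner ℝ (N z) (N z) : ℝ)) =ᶠ[𝓝 x] fun _ => 1 := by
    filter_upwards [hΩ.mem_nhds hx] with z hz
    rw [real_inner_self_eq_norm_sq, hN.norm_eq_one z hz, one_pow]
  rw [pd_congr h2, pd_const, real_inner_comm (N x)] at h1
  linarith

/-- The second fundamental form is symmetric. -/
lemma IsUnitNormalOn.secondForm_symm (hN : IsUnitNormalOn F N Ω) (hΩ : IsOpen Ω)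
    (hF : ContMDiff (𝓡 n) 𝓘(ℝ, Amb n) ∞ F) {x : M} (hx : x ∈ Ω) (i j : Fin n) :
    secondForm F N x i j = secondForm F N x j i := by
  set φ := chartAt (EuclideanSpace ℝ (Fin n)) x
  have hφ : φ ∈ atlas (EuclideanSpace ℝ (Fin n)) M := chart_mem_atlas _ x
  have hy : φ x ∈ φ.target := mem_chart_target _ x
  have hnhds := φ.open_target.mem_nhds hy
  have hinv : φ.symm (φ x) = x := φ.left_inv (mem_chart_source _ x)
  have hNx := hN.contMDiffAt hΩ hx
  have h0 : ∀ j, (fun z => (inner ℝ ((N ∘ φ.symm) z) (cpd φ F z j) : ℝ)) =ᶠ[𝓝 (φ x)]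
      fun _ => 0 := by
    intro j
    have hΩ' : ∀ᶠ z in 𝓝 (φ x), φ.symm z ∈ Ω :=
      (φ.continuousAt_symm hy).eventually (by rw [hinv]; exact hΩ.mem_nhds hx)
    filter_upwards [hnhds, hΩ'] with z hz hzΩ
    have hmem : cpd φ F z j ∈ Submodule.span ℝ (Set.range (pd (n := n) F (φ.symm z))) := by
      rw [pd_eq_changeFrame hφ (φ.map_target hz) (hF _),
        span_changeFrame (isUnit_det_frameMat hφ (φ.map_target hz)), φ.right_inv hz]
      exact Submodule.subset_span ⟨j, rfl⟩
    exact inner_eq_zero_of_mem_span hmem (hN.normal _ hzΩ)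
  -- Differentiate ⟨N,∂_jF⟩ = 0 in one fixed chart; the symmetry is then that of the second
  -- derivatives of F.
  have h1 : ∀ i j, inner ℝ (cpd φ N (φ x) i) (cpd φ F (φ x) j) =
      -inner ℝ (N x) (cpd₂ φ F (φ x) i j) := by
    intro i j
    have hF' : HasFDerivAt (fun z => cpd φ F z j) (fderiv ℝ (fun z => cpd φ F z j) (φ x)) (φ x) :=
      (((contDiffOn_cpd hφ hF j).contDiffAt hnhds).differentiableAt (by simp)).hasFDerivAt
    have h2 := ((hasFDerivAt_chartAt hNx).inner ℝ hF').congr_of_eventuallyEq (h0 j).symm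
    have h3 := congrArg (fun L => L (EuclideanSpace.single i (1 : ℝ)))
      (h2.unique (hasFDerivAt_const (0 : ℝ) (φ x)))
    simp at h3
    have h4 : inner ℝ (N x) (cpd₂ φ F (φ x) i j) + inner ℝ (cpd φ N (φ x) i) (cpd φ F (φ x) j)
        = 0 := h3
    linarith
  simp only [secondForm, Matrix.of_apply]
  rw [pd_eq_cpd hNx, pd_eq_cpd (hF x)]
  change inner ℝ (cpd φ N (φ x) i) (cpd φ F (φ x) j) = inner ℝ (cpd φ N (φ x) j) (cpd φ F (φ x) i)
  rw [h1, h1, cpd₂_symm hφ hy (hF _)]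

/-- The weighted divergence of a tangential field. -/
lemma surfaceDiv_exp_smul (hF : ContMDiff (𝓡 n) 𝓘(ℝ, Amb n) ∞ F) {x : M}
    (himm : (metric F x).det ≠ 0) (hT : ContMDiffAt (𝓡 n) 𝓘(ℝ, Amb n) ∞ T x)
    (htan : T x ∈ Submodule.span ℝ (Set.range (pd (n := n) F x))) :
    surfaceDiv F (fun z => Real.exp (-height F z) • T z) x =
      Real.exp (-height F x) * (surfaceDiv F T x - inner ℝ (eLast n) (T x)) := by
  have hh := contMDiffAt_height (hF x)
  have h1 : pd (n := n) (fun z => Real.exp (-height F z) • T z) x = fun i =>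
      Real.exp (-height F x) • pd T x i +
        (-Real.exp (-height F x) * inner ℝ (eLast n) (pd F x i)) • T x := by
    funext i
    rw [pd_smul (contMDiffAt_exp_neg hh) hT, pd_exp_neg hh, pd_height (hF x), neg_mul]
  rw [surfaceDiv_eq_frameDiv, h1, frameDiv_mul_add, frameGrad_smul, real_inner_smul_right,
    inner_frameGrad_inner himm htan, surfaceDiv_eq_frameDiv]
  ring

/-- The divergence of a normal field. -/
lemma IsUnitNormalOn.surfaceDiv_smul (hN : IsUnitNormalOn F N Ω) (hΩ : IsOpen Ω) {x : M}
    (hx : x ∈ Ω) (hu : ContMDiffAt (𝓡 n) 𝓘(ℝ, ℝ) ∞ u x) :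
    surfaceDiv F (fun z => u z • N z) x = u x * meanCurv F N x := by
  have h1 : pd (n := n) (fun z => u z • N z) x = fun i => u x • pd N x i + pd u x i • N x := by
    funext i; exact pd_smul hu (hN.contMDiffAt hΩ hx) i
  rw [surfaceDiv_eq_frameDiv, h1, frameDiv_mul_add,
    inner_eq_zero_of_mem_span (frameGrad_mem_span _ _) (hN.normal x hx), add_zero]
  rfl

/-- Since ∂_i f = ⟨e,∂_iF⟩, contracting with gⁱʲ∂_ju gives the product of e with the pushed-forward
gradient of u. -/
lemma driftLaplacian_eq (hF : ContMDiff (𝓡 n) 𝓘(ℝ, Amb n) ∞ F) (u : M → ℝ) (x : M) :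
    driftLaplacian F u x = laplacian F u x - inner ℝ (eLast n) (grad F u x) := by
  rw [driftLaplacian, grad_eq_frameGrad, inner_eq_sum_frameGrad, innerGrad, Finset.sum_comm]
  congr 1
  refine Finset.sum_congr rfl fun i _ => Finset.sum_congr rfl fun j _ => ?_
  rw [metric_eq_gram, gram_inv_symm, pd_height (hF x)]
  ring

/-- The pointwise form of the integration by parts behind the second variation. -/
lemma surfaceDiv_exp_smul_grad (N : M → Amb n) (hF : ContMDiff (𝓡 n) 𝓘(ℝ, Amb n) ∞ F)
    (himm : ∀ x, (metric F x).det ≠ 0) (hu : ContMDiff (𝓡 n) 𝓘(ℝ, ℝ) ∞ u) (x : M) :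
    surfaceDiv F (fun z => Real.exp (-height F z) • (u z • grad F u z)) x =
      Real.exp (-height F x) * (innerGrad F u u x - u x ^ 2 * normSqA F N x) +
        Real.exp (-height F x) * (u x * stabilityOp F N u x) := by
  have hg := contMDiff_grad hF himm hu
  rw [surfaceDiv_exp_smul (T := fun z => u z • grad F u z) hF (himm x) ((hu x).smul (hg x))
    (Submodule.smul_mem _ _ (frameGrad_mem_span _ _)), stabilityOp, driftLaplacian_eq hF,
    laplacian, real_inner_smul_right]
  have h1 : pd (n := n) (fun z => u z • grad F u z) x = fun i =>
      u x • pd (grad F u) x i + pd u x i • grad F u x := by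
    funext i; exact pd_smul (hu x) (hg x) i
  have h2 : inner ℝ (grad F u x) (frameGrad (pd (n := n) F x) (pd u x)) = innerGrad F u u x := by
    rw [inner_eq_sum_frameGrad, innerGrad]
    refine Finset.sum_congr rfl fun i _ => Finset.sum_congr rfl fun j _ => ?_
    rw [grad_eq_frameGrad, inner_frameGrad (himm x)]
    rfl
  -- The two |A|² terms on the right cancel, so N is arbitrary here; they are present only to make
  -- the stability operator appear.
  rw [surfaceDiv_eq_frameDiv, h1, frameDiv_mul_add, h2, surfaceDiv_eq_frameDiv]
  ring

end Normal
-- The first variation formula.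
section FirstVariation

open MeasureTheory

variable {n : ℕ} {M : Type*} [TopologicalSpace M] [ChartedSpace (EuclideanSpace ℝ (Fin n)) M]
  [IsManifold (𝓡 n) ∞ M] [T2Space M] {F N X : M → Amb n} {Ω K : Set M} {u : M → ℝ}

lemma eventuallyEq_zero_of_notMem {V : Type*} [Zero V] {G : M → V} (hK : IsCompact K)
    (hG : ∀ x ∉ K, G x = 0) {x : M} (hx : x ∉ K) : G =ᶠ[𝓝 x] 0 := by
  filter_upwards [hK.isClosed.isOpen_compl.mem_nhds hx] with z hz using hG z hz

lemma pd_eq_zero_of_notMem {V : Type*} [NormedAddCommGroup V] [NormedSpace ℝ V] {G : M → V}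
    (hK : IsCompact K) (hG : ∀ x ∉ K, G x = 0) {x : M} (hx : x ∉ K) : pd (n := n) G x = 0 := by
  funext i
  rw [pd_congr (eventuallyEq_zero_of_notMem hK hG hx)]
  exact pd_const 0 x i

lemma surfaceDiv_eq_zero_of_notMem (hK : IsCompact K) (hX : ∀ x ∉ K, X x = 0) {x : M}
    (hx : x ∉ K) : surfaceDiv F X x = 0 := by
  simp [surfaceDiv, pd_eq_zero_of_notMem hK hX hx]

/-- The first variation density `e^{-f} (div X - ⟨e, X⟩)` of the weighted area. -/
def weightedDiv (F X : M → Amb n) (x : M) : ℝ :=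
  Real.exp (-height F x) * (surfaceDiv F X x - inner ℝ (eLast n) (X x))

lemma weightedDiv_eq_zero_of_notMem (hK : IsCompact K) (hX : ∀ x ∉ K, X x = 0) {x : M}
    (hx : x ∉ K) : weightedDiv F X x = 0 := by
  rw [weightedDiv, surfaceDiv_eq_zero_of_notMem hK hX hx, hX x hx, inner_zero_right, sub_zero,
    mul_zero]

lemma continuous_weightedDiv (hF : ContMDiff (𝓡 n) 𝓘(ℝ, Amb n) ∞ F)
    (himm : ∀ x, (metric F x).det ≠ 0) (hX : ContMDiff (𝓡 n) 𝓘(ℝ, Amb n) ∞ X) :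
    Continuous (weightedDiv F X) :=
  (Real.continuous_exp.comp
    (continuous_iff_continuousAt.2 fun x => (contMDiffAt_height (hF x)).continuousAt).neg).mul
    ((contMDiff_surfaceDiv hF himm hX).continuous.sub (continuous_const.inner hX.continuous))

lemma contMDiff_exp_neg_height (hF : ContMDiff (𝓡 n) 𝓘(ℝ, Amb n) ∞ F) :
    ContMDiff (𝓡 n) 𝓘(ℝ, ℝ) ∞ fun x => Real.exp (-height F x) := fun x =>
  contMDiffAt_exp_neg (contMDiffAt_height (hF x))

variable [MeasurableSpace M] [BorelSpace M] [SecondCountableTopology M]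

lemma integrable_of_continuous_of_notMem (hF : ContMDiff (𝓡 n) 𝓘(ℝ, Amb n) ∞ F) {q : M → ℝ}
    (hq : Continuous q) (hK : IsCompact K) (hq0 : ∀ x ∉ K, q x = 0) :
    Integrable q (areaMeasure F) := by
  have := isLocallyFiniteMeasure_areaMeasure hF
  exact hq.integrable_of_hasCompactSupport (HasCompactSupport.intro hK hq0)

/-- The first variation formula: the tangential part of the variation field does not
contribute. -/
lemma integral_weightedDiv (hF : ContMDiff (𝓡 n) 𝓘(ℝ, Amb n) ∞ F)
    (himm : ∀ x, (metric F x).det ≠ 0) (hΩ : IsOpen Ω) (hN : IsUnitNormalOn F N Ω)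
    (hX : ContMDiff (𝓡 n) 𝓘(ℝ, Amb n) ∞ X) (hK : IsCompact K) (hKΩ : K ⊆ Ω)
    (hX0 : ∀ x ∉ K, X x = 0) :
    ∫ x, weightedDiv F X x ∂(areaMeasure F) = ∫ x, Real.exp (-height F x) *
      (inner ℝ (X x) (N x) * (meanCurv F N x - inner ℝ (eLast n) (N x))) ∂(areaMeasure F) := by
  -- Decomposition X = T + cN. N is controlled only on Ω, so smoothness and tangency of T are
  -- checked on K ⊆ Ω, and off K from X = 0.
  set c : M → ℝ := fun x => inner ℝ (X x) (N x)
  set T : M → Amb n := fun x => X x - c x • N x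
  have hc : ∀ x ∈ Ω, ContMDiffAt (𝓡 n) 𝓘(ℝ, ℝ) ∞ c x := fun x hx =>
    contMDiffAt_inner (hX x) (hN.contMDiffAt hΩ hx)
  have hT0 : ∀ x ∉ K, T x = 0 := fun x hx => by simp [T, c, hX0 x hx]
  have hT : ContMDiff (𝓡 n) 𝓘(ℝ, Amb n) ∞ T := by
    intro x
    by_cases hx : x ∈ K
    · exact (hX x).sub ((hc x (hKΩ hx)).smul (hN.contMDiffAt hΩ (hKΩ hx)))
    · exact (contMDiffAt_const (c := (0 : Amb n))).congr_of_eventuallyEq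
        (eventuallyEq_zero_of_notMem hK hT0 hx)
  have htan : ∀ x, T x ∈ Submodule.span ℝ (Set.range (pd (n := n) F x)) := by
    intro x
    by_cases hx : x ∈ K
    · have hν := hN.norm_eq_one x (hKΩ hx)
      refine mem_span_of_inner_normal_eq_zero (himm x) hν (hN.normal x (hKΩ hx)) ?_
      simp only [T, c]
      rw [inner_sub_right, real_inner_smul_right, real_inner_self_eq_norm_sq, hν,
        real_inner_comm]
      ring
    · rw [hT0 x hx]; exact Submodule.zero_mem _
  -- The weight is absorbed into the field: e^{-f}(div T - ⟨e,T⟩) = div(e^{-f}T), a pure divergence.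
  set W : M → Amb n := fun x => Real.exp (-height F x) • T x
  have hW : ContMDiff (𝓡 n) 𝓘(ℝ, Amb n) ∞ W := (contMDiff_exp_neg_height hF).smul hT
  have hW0 : ∀ x ∉ K, W x = 0 := fun x hx => by simp [W, hT0 x hx]
  have hpt : ∀ x, Real.exp (-height F x) *
      (c x * (meanCurv F N x - inner ℝ (eLast n) (N x))) =
        weightedDiv F X x - surfaceDiv F W x := by
    intro x
    by_cases hx : x ∈ K
    · have hxΩ := hKΩ hx
      have hsplit : surfaceDiv F X x = surfaceDiv F T x + c x * meanCurv F N x := by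
        rw [← hN.surfaceDiv_smul hΩ hxΩ (hc x hxΩ)]
        have : X = fun z => T z + c z • N z := by funext z; simp [T]
        have h2 : pd (n := n) X x = fun i => pd T x i + pd (fun z => c z • N z) x i := by
          conv_lhs => rw [this]
          funext i
          exact pd_add (hT x) ((hc x hxΩ).smul (hN.contMDiffAt hΩ hxΩ)) i
        rw [surfaceDiv_eq_frameDiv, h2, frameDiv_add]
        rfl
      have hXx : inner ℝ (eLast n) (X x) =
          inner ℝ (eLast n) (T x) + c x * inner ℝ (eLast n) (N x) := by
        simp only [T, inner_sub_right, real_inner_smul_right]; ring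
      rw [weightedDiv, surfaceDiv_exp_smul hF (himm x) (hT x) (htan x), hsplit, hXx]
      ring
    · rw [weightedDiv_eq_zero_of_notMem hK hX0 hx, surfaceDiv_eq_zero_of_notMem hK hW0 hx]
      simp [c, hX0 x hx]
  rw [integral_congr_ae (Filter.Eventually.of_forall hpt), integral_sub,
    integral_surfaceDiv_eq_zero hF himm hW (fun x => Submodule.smul_mem _ _ (htan x))
      (HasCompactSupport.intro hK hW0), sub_zero]
  · exact integrable_of_continuous_of_notMem hF (continuous_weightedDiv hF himm hX) hK
      fun x hx => weightedDiv_eq_zero_of_notMem hK hX0 hx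
  · exact integrable_of_continuous_of_notMem hF (contMDiff_surfaceDiv hF himm hW).continuous hK
      fun x hx => surfaceDiv_eq_zero_of_notMem hK hW0 hx

/-- Used twice: for the velocity in the first variation, and for the acceleration in the second. -/
lemma integral_weightedDiv_eq_zero (hF : ContMDiff (𝓡 n) 𝓘(ℝ, Amb n) ∞ F)
    (himm : ∀ x, (metric F x).det ≠ 0) (hΩ : IsOpen Ω) (hN : IsUnitNormalOn F N Ω)
    (htr : TranslatorEqOn F N Ω)
    (hX : ContMDiff (𝓡 n) 𝓘(ℝ, Amb n) ∞ X) (hK : IsCompact K) (hKΩ : K ⊆ Ω)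
    (hX0 : ∀ x ∉ K, X x = 0) : ∫ x, weightedDiv F X x ∂(areaMeasure F) = 0 := by
  rw [integral_weightedDiv hF himm hΩ hN hX hK hKΩ hX0]
  refine integral_eq_zero_of_ae (Filter.Eventually.of_forall fun x => ?_)
  by_cases hx : x ∈ K
  · simp [htr x (hKΩ hx)]
  · simp [hX0 x hx]

end FirstVariation

/-! ### Variations through immersions, the Euler–Lagrange equation and the second variation. -/

section Variations

open MeasureTheory

variable {n : ℕ} {M : Type*} [TopologicalSpace M] [ChartedSpace (EuclideanSpace ℝ (Fin n)) M]
  [IsManifold (𝓡 n) ∞ M] [T2Space M] {F N X : M → Amb n} {Ω : Set M} {u : M → ℝ}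
  {Ψ : ℝ → M → Amb n}

variable (F Ω Ψ) in
/-- A compactly supported smooth variation through immersions. -/
structure ImmersedVariation (a : ℝ) (K : Set M) : Prop where
  pos : 0 < a
  smooth : SmoothFam n a Ψ
  zero : Ψ 0 = F
  isCompact : IsCompact K
  subset : K ⊆ Ω
  const : ∀ s ∈ Set.Ioo (-a) a, ∀ x ∉ K, Ψ s x = F x
  immersed : ∀ s ∈ Set.Ioo (-a) a, ∀ x, (metric (Ψ s) x).det ≠ 0

/-- Reduces to a single time interval on which smoothness, the common compact support and the
immersion property hold together. -/
lemma IsVariation.exists_immersedVariation (hF : ContMDiff (𝓡 n) 𝓘(ℝ, Amb n) ∞ F)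
    (himm : ∀ x, (metric F x).det ≠ 0) (hΨ : IsVariation F Ω Ψ) :
    ∃ a K, ImmersedVariation F Ω Ψ a K := by
  obtain ⟨a, ha, h1⟩ := hΨ.smooth
  obtain ⟨b, hb, K, hK, hKΩ, hconst⟩ := hΨ.support
  have hab : 0 < min a b := lt_min ha hb
  have hs : SmoothFam n (min a b) Ψ := (smoothFam_of_contMDiffOn h1).mono (min_le_left _ _)
  have hc : ∀ s ∈ Set.Ioo (-min a b) (min a b), ∀ x ∉ K, Ψ s x = F x := fun s hs =>
    hconst s (Set.Ioo_subset_Ioo (neg_le_neg (min_le_right _ _)) (min_le_right _ _) hs)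
  obtain ⟨c, hc0, hcle, him⟩ :=
    exists_forall_det_metric_ne_zero hab hF himm hs hΨ.zero hK hc
  exact ⟨c, K, hc0, hs.mono hcle, hΨ.zero, hK, hKΩ, fun s h =>
    hc s (Set.Ioo_subset_Ioo (neg_le_neg hcle) hcle h), him⟩

namespace ImmersedVariation

variable {a : ℝ} {K : Set M} (h : ImmersedVariation F Ω Ψ a K)
include h

lemma zero_mem : (0 : ℝ) ∈ Set.Ioo (-a) a := ⟨by linarith [h.pos], h.pos⟩

lemma contMDiff : ContMDiff (𝓡 n) 𝓘(ℝ, Amb n) ∞ F := by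
  rw [← h.zero]; exact h.smooth.contMDiff h.zero_mem

lemma immersion : ∀ x, (metric F x).det ≠ 0 := by
  have := h.immersed 0 h.zero_mem
  rwa [h.zero] at this

lemma dot_eq_zero {s : ℝ} (hs : s ∈ Set.Ioo (-a) a) {x : M} (hx : x ∉ K) : dot Ψ s x = 0 :=
  dot_eq_zero_of_const (fun r hr => by rw [h.const r hr x hx, h.zero]) hs

lemma dot_dot_eq_zero {s : ℝ} (hs : s ∈ Set.Ioo (-a) a) {x : M} (hx : x ∉ K) :
    dot (dot Ψ) s x = 0 :=
  dot_eq_zero_of_const (fun r hr => by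
    rw [h.dot_eq_zero hr hx, h.dot_eq_zero h.zero_mem hx]) hs

lemma smoothFam_weightedDensity : SmoothFam n a fun s => weightedDensity F (Ψ s) :=
  WeightedArea.smoothFam_weightedDensity h.contMDiff h.immersion h.smooth h.immersed

lemma dot_weightedDensity_eq_zero {s : ℝ} (hs : s ∈ Set.Ioo (-a) a) {x : M} (hx : x ∉ K) :
    dot (fun s => weightedDensity F (Ψ s)) s x = 0 :=
  dot_eq_zero_of_const (fun _ hr => weightedDensity_eq_of_notMem h.isCompact h.zero h.const hr hx)
    hs

lemma dot_dot_weightedDensity_eq_zero {s : ℝ} (hs : s ∈ Set.Ioo (-a) a) {x : M} (hx : x ∉ K) :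
    dot (dot fun s => weightedDensity F (Ψ s)) s x = 0 :=
  dot_eq_zero_of_const (fun r hr => by
    rw [h.dot_weightedDensity_eq_zero hr hx, h.dot_weightedDensity_eq_zero h.zero_mem hx]) hs

variable [MeasurableSpace M] [BorelSpace M] [SecondCountableTopology M]

lemma hasDerivAt_weightedArea (hΩ : IsOpen Ω) (hΩ' : IsCompact (closure Ω)) {s : ℝ}
    (hs : s ∈ Set.Ioo (-a) a) : HasDerivAt (fun t => weightedArea (Ψ t) Ω)
      (∫ x in Ω, dot (fun t => weightedDensity F (Ψ t)) s x ∂(areaMeasure F)) s := by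
  have := isLocallyFiniteMeasure_areaMeasure h.contMDiff
  refine (h.smoothFam_weightedDensity.hasDerivAt_setIntegral hΩ' h.isCompact
    (fun r hr x hx => weightedDensity_eq_of_notMem h.isCompact h.zero h.const hr hx)
    hs).congr_of_eventuallyEq ?_
  filter_upwards [isOpen_Ioo.mem_nhds hs] with t ht
  exact weightedArea_eq_setIntegral h.contMDiff h.immersion (h.smooth.contMDiff ht) hΩ

lemma hasDerivAt_deriv_weightedArea (hΩ : IsOpen Ω) (hΩ' : IsCompact (closure Ω)) :
    HasDerivAt (deriv fun t => weightedArea (Ψ t) Ω)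
      (∫ x in Ω, dot (dot fun t => weightedDensity F (Ψ t)) 0 x ∂(areaMeasure F)) 0 := by
  have := isLocallyFiniteMeasure_areaMeasure h.contMDiff
  refine (h.smoothFam_weightedDensity.dot.hasDerivAt_setIntegral hΩ' h.isCompact
    (fun r hr x hx => by rw [h.dot_weightedDensity_eq_zero hr hx,
      h.dot_weightedDensity_eq_zero h.zero_mem hx]) h.zero_mem).congr_of_eventuallyEq ?_
  filter_upwards [isOpen_Ioo.mem_nhds h.zero_mem] with t ht
  exact (h.hasDerivAt_weightedArea hΩ hΩ' ht).deriv

lemma setIntegral_eq_integral {q : M → ℝ} (hq : ∀ x ∉ K, q x = 0) :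
    ∫ x in Ω, q x ∂(areaMeasure F) = ∫ x, q x ∂(areaMeasure F) :=
  setIntegral_eq_integral_of_forall_compl_eq_zero fun x hx => hq x fun hK => hx (h.subset hK)

/-- The first variation of the weighted area. -/
lemma hasDerivAt_weightedArea_zero (hΩ : IsOpen Ω) (hΩ' : IsCompact (closure Ω)) :
    HasDerivAt (fun t => weightedArea (Ψ t) Ω)
      (∫ x, weightedDiv F (dot Ψ 0) x ∂(areaMeasure F)) 0 := by
  refine (h.hasDerivAt_weightedArea hΩ hΩ' h.zero_mem).congr_deriv ?_
  rw [h.setIntegral_eq_integral fun x hx => h.dot_weightedDensity_eq_zero h.zero_mem hx]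
  refine integral_congr_ae (Filter.Eventually.of_forall fun x => ?_)
  rw [dot_weightedDensity h.smooth h.immersed h.zero_mem, h.zero,
    weightedDensity_self (h.immersion x), weightedDiv]

/-- The pointwise second variation in a normal direction. -/
lemma dot_dot_weightedDensity_normal (hΩ : IsOpen Ω) (hN : IsUnitNormalOn F N Ω)
    (htr : TranslatorEqOn F N Ω) (hu : ContMDiff (𝓡 n) 𝓘(ℝ, ℝ) ∞ u)
    (hΨ : dot Ψ 0 = fun x => u x • N x) {x : M} (hx : x ∈ Ω) :
    dot (dot fun t => weightedDensity F (Ψ t)) 0 x =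
      Real.exp (-height F x) * (innerGrad F u u x - u x ^ 2 * normSqA F N x) +
        weightedDiv F (dot (dot Ψ) 0) x := by
  have hF := h.contMDiff
  have hNx := hN.contMDiffAt hΩ hx
  have h1 : pd (n := n) (dot Ψ 0) x = fun i => u x • pd N x i + pd u x i • N x := by
    rw [hΨ]; funext i; exact pd_smul (hu x) hNx i
  -- For velocity uN the squared term is (uH - u⟨e,N⟩)², which the translator equation makes zero
  -- pointwise.
  rw [dot_dot_weightedDensity h.pos h.immersion h.smooth h.zero h.immersed, h1,
    frameHess_normal (h.immersion x) (hN.norm_eq_one x hx) (hN.normal x hx)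
      (hN.inner_pd_eq_zero hΩ hx) (hN.secondForm_symm hΩ hF hx), hΨ,
    hN.surfaceDiv_smul hΩ hx (hu x), real_inner_smul_right, htr x hx, sub_self, weightedDiv]
  simp only [innerGrad, normSqA, metric_eq_gram, secondForm, crossGram]
  ring

end ImmersedVariation

/-- A linear variation of an immersion. -/
lemma isVariation_add_smul {K : Set M} (hF : ContMDiff (𝓡 n) 𝓘(ℝ, Amb n) ∞ F)
    (hX : ContMDiff (𝓡 n) 𝓘(ℝ, Amb n) ∞ X) (hK : IsCompact K) (hKΩ : K ⊆ Ω)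
    (hX0 : ∀ x ∉ K, X x = 0) : IsVariation F Ω fun s x => F x + s • X x := by
  refine ⟨⟨1, one_pos, ?_⟩, by funext x; simp,
    ⟨1, one_pos, K, hK, hKΩ, fun s _ x hx => by simp [hX0 x hx]⟩⟩
  exact ((hF.comp contMDiff_snd).add (contMDiff_fst.smul (hX.comp contMDiff_snd))).contMDiffOn

variable [MeasurableSpace M] [BorelSpace M] [SecondCountableTopology M]

lemma isStationaryOn_of_translatorEqOn (hF : ContMDiff (𝓡 n) 𝓘(ℝ, Amb n) ∞ F)
    (himm : ∀ x, (metric F x).det ≠ 0) (hΩ : IsOpen Ω) (hΩ' : IsCompact (closure Ω))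
    (hN : IsUnitNormalOn F N Ω) (htr : TranslatorEqOn F N Ω) : IsStationaryOn F Ω := by
  intro Ψ hΨ
  obtain ⟨a, K, h⟩ := hΨ.exists_immersedVariation hF himm
  have h1 := h.hasDerivAt_weightedArea_zero hΩ hΩ'
  rwa [integral_weightedDiv_eq_zero hF himm hΩ hN htr (h.smooth.dot.contMDiff h.zero_mem)
    h.isCompact h.subset fun x hx => h.dot_eq_zero h.zero_mem hx] at h1

/-- Test with X = ζ²(H - ⟨e,N⟩)N on Ω, where ζ is a bump function at x₀ supported in Ω. The first
variation is then ∫ e^{-f}(ζ(H - ⟨e,N⟩))², which forces the continuous integrand to vanish at x₀,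
where ζ = 1. -/
lemma translatorEqOn_of_isStationaryOn (hF : ContMDiff (𝓡 n) 𝓘(ℝ, Amb n) ∞ F)
    (himm : ∀ x, (metric F x).det ≠ 0) (hΩ : IsOpen Ω) (hΩ' : IsCompact (closure Ω))
    (hN : IsUnitNormalOn F N Ω) (hst : IsStationaryOn F Ω) : TranslatorEqOn F N Ω := by
  intro x₀ hx₀
  have := isLocallyFiniteMeasure_areaMeasure hF
  have := isOpenPosMeasure_areaMeasure hF himm
  obtain ⟨ζ, -, hζ⟩ := (SmoothBumpFunction.nhds_basis_tsupport (I := 𝓡 n) x₀).mem_iff.1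
    (hΩ.mem_nhds hx₀)
  set K := tsupport ζ
  have hK : IsCompact K := ζ.hasCompactSupport
  have hζs : ContMDiff (𝓡 n) 𝓘(ℝ, ℝ) ∞ ζ := ζ.contMDiff
  set Z : M → Amb n := fun x => ζ x • N x
  have hZ0 : ∀ x ∉ K, Z x = 0 := fun x hx => by
    simp [Z, image_eq_zero_of_notMem_tsupport hx]
  have hZ : ContMDiff (𝓡 n) 𝓘(ℝ, Amb n) ∞ Z := by
    intro x
    by_cases hx : x ∈ K
    · exact (hζs x).smul (hN.contMDiffAt hΩ (hζ hx))
    · exact (contMDiffAt_const (c := (0 : Amb n))).congr_of_eventuallyEq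
        (eventuallyEq_zero_of_notMem hK hZ0 hx)
  -- On Ω this is ζ(H - ⟨e,N⟩); written through Z = ζN it is visibly smooth on all of M, also where
  -- N is not.
  set c : M → ℝ := fun x => surfaceDiv F Z x - inner ℝ (eLast n) (Z x)
  have hc : ContMDiff (𝓡 n) 𝓘(ℝ, ℝ) ∞ c := fun x =>
    (contMDiff_surfaceDiv hF himm hZ x).sub (contMDiffAt_inner contMDiffAt_const (hZ x))
  have hcΩ : ∀ x ∈ Ω, c x = ζ x * (meanCurv F N x - inner ℝ (eLast n) (N x)) := fun x hx => by
    simp only [c, Z]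
    rw [hN.surfaceDiv_smul hΩ hx (hζs x), real_inner_smul_right, mul_sub]
  have hc0 : ∀ x ∉ K, c x = 0 := fun x hx => by
    simp only [c]
    rw [surfaceDiv_eq_zero_of_notMem hK hZ0 hx, hZ0 x hx, inner_zero_right, sub_zero]
  set X : M → Amb n := fun x => c x • Z x
  have hX : ContMDiff (𝓡 n) 𝓘(ℝ, Amb n) ∞ X := hc.smul hZ
  have hX0 : ∀ x ∉ K, X x = 0 := fun x hx => by simp [X, hZ0 x hx]
  have hvar := isVariation_add_smul hF hX hK hζ hX0
  obtain ⟨a, K', h⟩ := hvar.exists_immersedVariation hF himm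
  have hdot : dot (fun s x => F x + s • X x) 0 = X := by
    funext x
    have : HasDerivAt (fun s : ℝ => F x + s • X x) (X x) 0 := by
      simpa using ((hasDerivAt_id (0 : ℝ)).smul_const (X x)).const_add (F x)
    exact this.deriv
  have h1 := (h.hasDerivAt_weightedArea_zero hΩ hΩ').unique (hst _ hvar)
  rw [hdot, integral_weightedDiv hF himm hΩ hN hX hK hζ hX0] at h1
  have h2 : ∀ x, Real.exp (-height F x) *
      (inner ℝ (X x) (N x) * (meanCurv F N x - inner ℝ (eLast n) (N x))) =
        Real.exp (-height F x) * c x ^ 2 := by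
    intro x
    by_cases hx : x ∈ K
    · have hν : inner ℝ (N x) (N x) = (1 : ℝ) := by
        rw [real_inner_self_eq_norm_sq, hN.norm_eq_one x (hζ hx), one_pow]
      simp only [X, Z, real_inner_smul_left, hν]
      rw [hcΩ x (hζ hx)]
      ring
    · rw [hX0 x hx, hc0 x hx]; simp
  rw [integral_congr_ae (Filter.Eventually.of_forall h2)] at h1
  have hcx : c x₀ = 0 := by
    by_contra hne
    have hcont : Continuous fun x => Real.exp (-height F x) * c x ^ 2 :=
      (contMDiff_exp_neg_height hF).continuous.mul (hc.continuous.pow 2)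
    refine (hcont.integral_pos_of_hasCompactSupport_nonneg_nonzero (x := x₀)
      (HasCompactSupport.intro hK fun x hx => by simp [hc0 x hx])
      (fun x => by positivity) (by positivity)).ne' h1
  rw [hcΩ x₀ hx₀, ζ.eq_one, one_mul] at hcx
  exact sub_eq_zero.1 hcx

/-- The second variation formula for translators. -/
lemma second_variation (hF : ContMDiff (𝓡 n) 𝓘(ℝ, Amb n) ∞ F)
    (himm : ∀ x, (metric F x).det ≠ 0) (hΩ : IsOpen Ω) (hΩ' : IsCompact (closure Ω))
    (hN : IsUnitNormalOn F N Ω) (htr : TranslatorEqOn F N Ω)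
    (hu : ContMDiff (𝓡 n) 𝓘(ℝ, ℝ) ∞ u) (huc : HasCompactSupport u) (huΩ : tsupport u ⊆ Ω)
    (hΨ : IsVariation F Ω Ψ) (hΨu : ∀ x, HasDerivAt (fun s => Ψ s x) (u x • N x) 0) :
    Integrable (fun x => Real.exp (-height F x) * (u x * stabilityOp F N u x)) (areaMeasure F) ∧
      (∀ᶠ s in 𝓝 (0 : ℝ), DifferentiableAt ℝ (fun s => weightedArea (Ψ s) Ω) s) ∧
      HasDerivAt (deriv fun s => weightedArea (Ψ s) Ω)
        (-∫ x, Real.exp (-height F x) * (u x * stabilityOp F N u x) ∂(areaMeasure F)) 0 := by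
  obtain ⟨a, K, h⟩ := hΨ.exists_immersedVariation hF himm
  have hdot : dot Ψ 0 = fun x => u x • N x := funext fun x => (hΨu x).deriv
  set Y := dot (dot Ψ) 0
  have hY : ContMDiff (𝓡 n) 𝓘(ℝ, Amb n) ∞ Y := h.smooth.dot.dot.contMDiff h.zero_mem
  have hY0 : ∀ x ∉ K, Y x = 0 := fun x hx => h.dot_dot_eq_zero h.zero_mem hx
  set W : M → Amb n := fun z => Real.exp (-height F z) • (u z • grad F u z)
  have hW : ContMDiff (𝓡 n) 𝓘(ℝ, Amb n) ∞ W :=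
    (contMDiff_exp_neg_height hF).smul (hu.smul (contMDiff_grad hF himm hu))
  have hW0 : ∀ x ∉ tsupport u, W x = 0 := fun x hx => by
    simp [W, image_eq_zero_of_notMem_tsupport hx]
  set q : M → ℝ := fun x => Real.exp (-height F x) * (u x * stabilityOp F N u x)
  set D : M → ℝ := dot (dot fun t => weightedDensity F (Ψ t)) 0
  have hD : ContMDiff (𝓡 n) 𝓘(ℝ, ℝ) ∞ D :=
    h.smoothFam_weightedDensity.dot.dot.contMDiff h.zero_mem
  have hD0 : ∀ x ∉ K, D x = 0 := fun x hx => h.dot_dot_weightedDensity_eq_zero h.zero_mem hx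
  -- The pointwise identity behind the formula: of the three terms on the right, the first
  -- integrates to zero by the divergence theorem and the second by the translator equation. Off Ω,
  -- where N is uncontrolled, every term vanishes.
  have hq : ∀ x, q x = surfaceDiv F W x + weightedDiv F Y x - D x := by
    intro x
    by_cases hx : x ∈ Ω
    · simp only [q, D, W]
      rw [h.dot_dot_weightedDensity_normal hΩ hN htr hu hdot hx,
        surfaceDiv_exp_smul_grad N hF himm hu]
      ring
    · have hxK : x ∉ K := fun hK => hx (h.subset hK)
      have hxu : x ∉ tsupport u := fun hK => hx (huΩ hK)
      rw [hD0 x hxK, weightedDiv_eq_zero_of_notMem h.isCompact hY0 hxK,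
        surfaceDiv_eq_zero_of_notMem huc hW0 hxu]
      simp [q, image_eq_zero_of_notMem_tsupport hxu]
  have hWi : Integrable (surfaceDiv F W) (areaMeasure F) :=
    integrable_of_continuous_of_notMem hF (contMDiff_surfaceDiv hF himm hW).continuous huc
      fun x hx => surfaceDiv_eq_zero_of_notMem huc hW0 hx
  have hYi : Integrable (weightedDiv F Y) (areaMeasure F) :=
    integrable_of_continuous_of_notMem hF (continuous_weightedDiv hF himm hY) h.isCompact
      fun x hx => weightedDiv_eq_zero_of_notMem h.isCompact hY0 hx
  have hDi : Integrable D (areaMeasure F) :=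
    integrable_of_continuous_of_notMem hF hD.continuous h.isCompact hD0
  -- Integrability is read off from `hq`, whose right-hand side is continuous with compact support,
  -- so no regularity of H or |A|² is needed.
  have hqi : Integrable q (areaMeasure F) := by
    rw [funext hq]; exact (hWi.add hYi).sub hDi
  refine ⟨hqi, ?_, ?_⟩
  · filter_upwards [isOpen_Ioo.mem_nhds h.zero_mem] with s hs using
      (h.hasDerivAt_weightedArea hΩ hΩ' hs).differentiableAt
  · refine (h.hasDerivAt_deriv_weightedArea hΩ hΩ').congr_deriv ?_
    have hsum : ∫ x, q x ∂(areaMeasure F) = (∫ x, surfaceDiv F W x ∂(areaMeasure F)) +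
        (∫ x, weightedDiv F Y x ∂(areaMeasure F)) - ∫ x, D x ∂(areaMeasure F) := by
      have hWY : Integrable (fun x => surfaceDiv F W x + weightedDiv F Y x) (areaMeasure F) :=
        hWi.add hYi
      rw [← integral_add hWi hYi, ← integral_sub hWY hDi]
      exact integral_congr_ae (Filter.Eventually.of_forall hq)
    rw [h.setIntegral_eq_integral hD0, hsum,
      integral_surfaceDiv_eq_zero hF himm hW
        (fun x => Submodule.smul_mem _ _ (Submodule.smul_mem _ _ (frameGrad_mem_span _ _)))
        (HasCompactSupport.intro huc hW0),
      integral_weightedDiv_eq_zero hF himm hΩ hN htr hY h.isCompact h.subset hY0]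
    ring

end Variations
end WeightedArea

end

theorem mainTheorem3 {n : ℕ} {M : Type*} [TopologicalSpace M] [T2Space M]
    [SecondCountableTopology M] [ChartedSpace (EuclideanSpace ℝ (Fin n)) M]
    [IsManifold (𝓡 n) ∞ M] [MeasurableSpace M] [BorelSpace M]
    (F : M → WeightedArea.Amb n)
    (hF : ContMDiff (𝓡 n) 𝓘(ℝ, WeightedArea.Amb n) ∞ F)
    (hF' : ∀ x, Function.Injective (mfderiv (𝓡 n) 𝓘(ℝ, WeightedArea.Amb n) F x))
    (Ω : Set M) (hΩ : IsOpen Ω) (hΩ' : IsCompact (closure Ω))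
    (N : M → WeightedArea.Amb n) (hN : WeightedArea.IsUnitNormalOn F N Ω) :
    (WeightedArea.TranslatorEqOn F N Ω ↔ WeightedArea.IsStationaryOn F Ω) ∧
    (WeightedArea.TranslatorEqOn F N Ω →
      ∀ u : M → ℝ, ContMDiff (𝓡 n) 𝓘(ℝ, ℝ) ∞ u → HasCompactSupport u → tsupport u ⊆ Ω →
      ∀ Ψ : ℝ → M → WeightedArea.Amb n, WeightedArea.IsVariation F Ω Ψ →
      (∀ x, HasDerivAt (fun s => Ψ s x) (u x • N x) 0) →
        MeasureTheory.Integrable (fun x => Real.exp (-WeightedArea.height F x) *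
          (u x * WeightedArea.stabilityOp F N u x)) (WeightedArea.areaMeasure F) ∧
        (∀ᶠ s in 𝓝 (0 : ℝ), DifferentiableAt ℝ (fun s => WeightedArea.weightedArea (Ψ s) Ω) s) ∧
        HasDerivAt (deriv fun s => WeightedArea.weightedArea (Ψ s) Ω)
          (-∫ x, Real.exp (-WeightedArea.height F x) *
            (u x * WeightedArea.stabilityOp F N u x) ∂(WeightedArea.areaMeasure F)) 0) ∧
    (∀ u : M → ℝ, ContMDiff (𝓡 n) 𝓘(ℝ, ℝ) ∞ u → ∀ x,
      WeightedArea.driftLaplacian F u x = WeightedArea.laplacian F u x -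
        inner ℝ (WeightedArea.eLast n) (WeightedArea.grad F u x)) := by
  have himm := fun x => WeightedArea.det_metric_ne_zero (hF' x)
  exact ⟨⟨WeightedArea.isStationaryOn_of_translatorEqOn hF himm hΩ hΩ' hN,
      WeightedArea.translatorEqOn_of_isStationaryOn hF himm hΩ hΩ' hN⟩,
    fun htr u hu huc huΩ Ψ hΨ hΨu =>
      WeightedArea.second_variation hF himm hΩ hΩ' hN htr hu huc huΩ hΨ hΨu,
    fun u _ x => WeightedArea.driftLaplacian_eq hF u x⟩
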